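/- **Setting.** All rings and algebras are unital. A Sylvester matrix rank function for a ring $S$ is a function $\mathrm{rk}$ with values in $\mathbb R_{\ge 0}$ on rectangular matrices over $S$ such that $\mathrm{rk}(0)=0$, $\mathrm{rk}(1_S)=1$, $\mathrm{rk}(AB)\le\min(\mathrm{rk}(A),\mathrm{rk}(B))$, $\mathrm{rk}\begin{pmatrix}A&0\\0&B\end{pmatrix}=\mathrm{rk}(A)+\mathrm{rk}(B)$ and $\mathrm{rk}\begin{pmatrix}A&C\\0&B\end{pmatrix}\ge\mathrm{rk}(A)+\mathrm{rk}(B)$ for all matrices of suitable sizes. Let $E/K$ be a field extension, $R$ a $K$-algebra and $\mathrm{rk}$ a Sylvester matrix rank function for $R$. Let $\hat{\mathcal F}_{E/K}$ be the set of nonzero finite-dimensional $K$-linear subspaces $W$ of $E$. For $W\in\hat{\mathcal F}_{E/K}$ regard $W\otimes_K R$ as a left $R$-submodule of $E\otimes_K R$; it is free of rank $\dim_K W$. * For an $n\times m$ matrix $A$ over $E\otimes_K R$ choose $W'\in\hat{\mathcal F}_{E/K}$ with $(W\otimes_K R)A_{ij}\subseteq W'\otimes_K R$ for all $i,j$, and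 put $\mathrm{rk}_W(A)=\mathrm{rk}(B)$, where $B$ is the matrix over $R$ of the left $R$-linear map $(W\otimes_K R)^n\to(W'\otimes_K R)^m$, $x\mapsto xA$ (row vectors), in some $R$-bases. This does not depend on the choices. * For a finite set $V\subseteq E\otimes_K R$ and $\varepsilon>0$, call $W\in\hat{\mathcal F}_{E/K}$ $(V,\varepsilon)$-invariant if there is $W'\in\hat{\mathcal F}_{E/K}$ with $W\otimes_K R+(W\otimes_K R)V\subseteq W'\otimes_K R$ and $\dim_K W'\le(1+\varepsilon)\dim_K W$. Call an ultrafilter $\omega$ on $\hat{\mathcal F}_{E/K}$ non-principal (with respect to $R$) if for all such $V$ and $\varepsilon$ it contains the set of all $(V,\varepsilon)$-invariant $W$. * For a non-principal ultrafilter $\omega$ on $\hat{\mathcal F}_{E/K}$ put $$\mathrm{rk}_{E/K}(A)=\lim_{W\to\omega}\frac{\mathrm{rk}_W(A)}{\dim_K W}$$ for every matrix $A$ over $E\otimes_K R$. **Proposition 9.1.** Let $K\subseteq E\subseteq E'$ be fields and let $R$ be a $K$-algebra with a Sylvester matrix rank function $\mathrm{rk}$. Non-principal ultrafilters exist on $\hat{\mathcal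 F}_{E/K}$ and $\hat{\mathcal F}_{E'/K}$ (with respect to $R$) and on $\hat{\mathcal F}_{E'/E}$ (with respect to $E\otimes_K R$). For every choice of them, the function $\mathrm{rk}_{E/K}$ on matrices over $E\otimes_K R$, the function $(\mathrm{rk}_{E/K})_{E'/E}$ on matrices over $E'\otimes_E(E\otimes_K R)$, constructed from $\mathrm{rk}_{E/K}$, and the function $\mathrm{rk}_{E'/K}$ on matrices over $E'\otimes_K R$, constructed from $\mathrm{rk}$, are Sylvester matrix rank functions. Under the canonical identification $E'\otimes_E(E\otimes_K R)=E'\otimes_K R$, $$(\mathrm{rk}_{E/K})_{E'/E}=\mathrm{rk}_{E'/K}.$$ -/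

import Mathlib

open scoped TensorProduct

/-- Real functions on the set of all rectangular matrices over `R`. -/
abbrev MatrixFunction (R : Type*) : Type _ :=
  ∀ n m : ℕ, Matrix (Fin n) (Fin m) R → ℝ

/-- `rk` is a Sylvester matrix rank function for the unital ring `R`: a nonnegative real function on
all rectangular matrices over `R` (matrices with no rows or no columns are allowed; as zero matrices
they have rank `0`). -/
structure IsSylvesterMatrixRank {R : Type*} [Ring R]
    (rk : MatrixFunction R) : Prop where
  nonneg : ∀ {n m : ℕ} (A : Matrix (Fin n) (Fin m) R), 0 ≤ rk n m A
  map_zero : ∀ n m : ℕ, rk n m 0 = 0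
  map_one : rk 1 1 1 = 1
  mul_le : ∀ {n m l : ℕ} (A : Matrix (Fin n) (Fin m) R) (B : Matrix (Fin m) (Fin l) R),
    rk n l (A * B) ≤ min (rk n m A) (rk m l B)
  diag : ∀ {n m k l : ℕ} (A : Matrix (Fin n) (Fin m) R) (B : Matrix (Fin k) (Fin l) R),
    rk (n + k) (m + l)
        (Matrix.reindex finSumFinEquiv finSumFinEquiv (Matrix.fromBlocks A 0 0 B)) =
      rk n m A + rk k l B
  triangular : ∀ {n m k l : ℕ} (A : Matrix (Fin n) (Fin m) R) (B : Matrix (Fin k) (Fin l) R)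
    (C : Matrix (Fin n) (Fin l) R),
    rk n m A + rk k l B ≤ rk (n + k) (m + l)
      (Matrix.reindex finSumFinEquiv finSumFinEquiv (Matrix.fromBlocks A C 0 B))

/-- The nonzero finite-dimensional `K`-linear subspaces of `E`. -/
def FinSubspace (K E : Type*) [Field K] [Field E] [Algebra K E] : Type _ :=
  {W : Submodule K E // FiniteDimensional K W ∧ W ≠ ⊥}

namespace FieldExt

variable {K E R : Type*} [Field K] [Field E] [Algebra K E] [Ring R] [Algebra K R]

/-- The dimension of `W` over `K`, which is also the rank of the free left `R`-module `W ⊗ R`. -/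
noncomputable def dim (W : FinSubspace K E) : ℕ := Module.finrank K W.1

variable (R) in
/-- `W ⊗ R` inside `E ⊗ R`, for a `K`-linear subspace `W` of `E`. These, for `W` nonzero and
finite-dimensional, are the nonzero members of the finite approximation system of `E ⊗ R`. -/
noncomputable def tensorSub (W : FinSubspace K E) : Submodule K (E ⊗[K] R) :=
  Submodule.span K {x | ∃ w ∈ W.1, ∃ r : R, x = w ⊗ₜ[K] r}

/-- `W ⊗ R` is `(V, ε)`-invariant: `W ⊗ R + (W ⊗ R) V` is contained in some `W' ⊗ R` with
`dim W' ≤ (1 + ε) dim W`. -/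
def IsInvariant (V : Finset (E ⊗[K] R)) (ε : ℝ) (W : FinSubspace K E) : Prop :=
  ∃ W' : FinSubspace K E, (dim W' : ℝ) ≤ (1 + ε) * dim W ∧
    tensorSub R W ≤ tensorSub R W' ∧
    ∀ x ∈ tensorSub R W, ∀ v ∈ V, x * v ∈ tensorSub R W'

variable (R) in
/-- The ultrafilter `ω` is non-principal in the sense of amenable extensions: it contains, for all
`V` and `ε`, the set of `(V, ε)`-invariant members of the approximation system. -/
def NonPrincipal (ω : Ultrafilter (FinSubspace K E)) : Prop :=
  ∀ (V : Finset (E ⊗[K] R)) (ε : ℝ), 0 < ε → {W | IsInvariant V ε W} ∈ ω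

/-- The row vectors `w 0, …, w (l - 1)` form a basis of the left `R`-module `(W ⊗ R)ⁿ`, where
`r ∈ R` acts as left multiplication by `1 ⊗ r`. -/
def IsRowBasis (W : FinSubspace K E) {n l : ℕ} (w : Matrix (Fin l) (Fin n) (E ⊗[K] R)) : Prop :=
  (∀ a i, w a i ∈ tensorSub R W) ∧
    ∀ x : Fin n → E ⊗[K] R, (∀ i, x i ∈ tensorSub R W) →
      ∃! r : Fin l → R, ∀ i, x i = ∑ a, ((1 : E) ⊗ₜ[K] r a) * w a i

/-- `B` is a matrix over `R` of right multiplication by `A`, as a left `R`-linear map from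
`(W ⊗ R)ⁿ` to some `(W' ⊗ R)ᵐ` with `(W ⊗ R) A i j ⊆ W' ⊗ R`, with respect to some `R`-bases. -/
def Represents (W : FinSubspace K E) {n m l p : ℕ} (A : Matrix (Fin n) (Fin m) (E ⊗[K] R))
    (B : Matrix (Fin l) (Fin p) R) : Prop :=
  ∃ (W' : FinSubspace K E) (w : Matrix (Fin l) (Fin n) (E ⊗[K] R))
    (w' : Matrix (Fin p) (Fin m) (E ⊗[K] R)),
    (∀ i j, ∀ x ∈ tensorSub R W, x * A i j ∈ tensorSub R W') ∧
    IsRowBasis W w ∧ IsRowBasis W' w' ∧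
    w * A = B.map (fun r => (1 : E) ⊗ₜ[K] r) * w'

/-- `rk_W(A)`: the common value of `rk B` over all the matrices `B` that represent `A` on `W`. -/
noncomputable def rankOn (rk : MatrixFunction R) (W : FinSubspace K E) {n m : ℕ}
    (A : Matrix (Fin n) (Fin m) (E ⊗[K] R)) : ℝ :=
  sInf {t | ∃ (l p : ℕ) (B : Matrix (Fin l) (Fin p) R), Represents W A B ∧ t = rk l p B}

/-- The extension of `rk` from `R` to `E ⊗ R`: the limit of `rk_W(A) / dim W` along `ω`. -/
noncomputable def rankExt (rk : MatrixFunction R) (ω : Ultrafilter (FinSubspace K E)) :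
    MatrixFunction (E ⊗[K] R) := fun _ _ A =>
  Filter.limUnder (ω : Filter (FinSubspace K E)) fun W => rankOn rk W A / (dim W : ℝ)

end FieldExt

namespace FieldExt

/-! Well-definedness: `rankOn` does not depend on the choices, and the limit in `rankExt` exists. -/

variable {K E R : Type*} [Field K] [Field E] [Algebra K E] [Ring R] [Algebra K R]

lemma tensorSub_eq (W : FinSubspace K E) :
    tensorSub R W = LinearMap.range (W.1.subtype.rTensor R) := by
  apply le_antisymm
  · rw [tensorSub, Submodule.span_le]
    rintro _ ⟨w, hw, r, rfl⟩
    exact ⟨(⟨w, hw⟩ : W.1) ⊗ₜ r, by simp⟩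
  · rintro _ ⟨x, rfl⟩
    induction x using TensorProduct.induction_on with
    | zero => simp
    | tmul w r => exact Submodule.subset_span ⟨w, w.2, r, by simp⟩
    | add x y hx hy => rw [map_add]; exact add_mem hx hy

/-- A `K`-basis of `W` gives unique `R`-coordinates on `W ⊗ R`. -/
lemma coords (W : FinSubspace K E) {ι : Type*} [Fintype ι] (e : Module.Basis ι K W.1)
    (x : E ⊗[K] R) (hx : x ∈ tensorSub R W) :
    ∃! r : ι → R, x = ∑ a, (e a : E) ⊗ₜ[K] r a := by
  classical
  rw [tensorSub_eq] at hx
  obtain ⟨y, rfl⟩ := hx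
  have hinj : Function.Injective (W.1.subtype.rTensor R) :=
    Module.Flat.rTensor_preserves_injective_linearMap _ W.1.injective_subtype
  let T := TensorProduct.equivFinsuppOfBasisLeft (N := R) e
  have key : ∀ r : ι → R, T.symm (Finsupp.equivFunOnFinite.symm r) = ∑ a, e a ⊗ₜ[K] r a := by
    intro r
    simp only [T, TensorProduct.equivFinsuppOfBasisLeft_symm_apply]
    rw [Finsupp.sum_fintype _ _ (by simp)]
    simp
  have key2 : ∀ r : ι → R, W.1.subtype.rTensor R (T.symm (Finsupp.equivFunOnFinite.symm r)) =
      ∑ a, (e a : E) ⊗ₜ[K] r a := by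
    intro r; rw [key]; simp
  refine ⟨T y, ?_, ?_⟩
  · show _ = _
    rw [← key2]; congr 1
    rw [LinearEquiv.eq_symm_apply]; ext; simp
  · intro r hr
    rw [← key2] at hr
    have := hinj hr
    rw [LinearEquiv.eq_symm_apply] at this
    rw [this]; rfl

lemma exists_rowBasis (W : FinSubspace K E) (n : ℕ) :
    ∃ w : Matrix (Fin (n * dim W)) (Fin n) (E ⊗[K] R), IsRowBasis W w := by
  have := W.2.1
  let e : Module.Basis (Fin (dim W)) K W.1 := Module.finBasis K W.1
  refine ⟨fun a i => if (finProdFinEquiv.symm a).1 = i then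
    (e (finProdFinEquiv.symm a).2 : E) ⊗ₜ[K] (1 : R) else 0, ?_, ?_⟩
  · intro a i
    dsimp only
    split_ifs
    · exact Submodule.subset_span ⟨_, (e _).2, 1, rfl⟩
    · exact zero_mem _
  · intro x hx
    have h1 : ∀ (r : Fin (n * dim W) → R) i, ∑ a, ((1 : E) ⊗ₜ[K] r a) *
        (if (finProdFinEquiv.symm a).1 = i then
          (e (finProdFinEquiv.symm a).2 : E) ⊗ₜ[K] (1 : R) else 0) =
        ∑ b, (e b : E) ⊗ₜ[K] r (finProdFinEquiv (i, b)) := by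
      intro r i
      rw [← finProdFinEquiv.sum_comp, Fintype.sum_prod_type]
      rw [Finset.sum_eq_single i]
      · simp
      · intro j _ hj; simp [hj]
      · simp
    simp only [h1]
    choose r hr hu using fun i => coords W e (x i) (hx i)
    refine ⟨fun a => r (finProdFinEquiv.symm a).1 (finProdFinEquiv.symm a).2, ?_, ?_⟩
    · intro i; simpa using hr i
    · intro s hs
      ext a
      have := hu (finProdFinEquiv.symm a).1 (fun b => s (finProdFinEquiv ((finProdFinEquiv.symm a).1, b))) (hs _)
      have := congrFun this (finProdFinEquiv.symm a).2
      rwa [Prod.mk.eta, Equiv.apply_symm_apply] at this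

lemma smul_mem (W : FinSubspace K E) (r : R) {x : E ⊗[K] R} (hx : x ∈ tensorSub R W) :
    ((1 : E) ⊗ₜ[K] r) * x ∈ tensorSub R W := by
  induction hx using Submodule.span_induction with
  | mem x h => obtain ⟨w, hw, s, rfl⟩ := h; exact Submodule.subset_span ⟨w, hw, r * s, by simp⟩
  | zero => simp
  | add x y _ _ hx hy => rw [mul_add]; exact add_mem hx hy
  | smul c x _ hx => rw [mul_smul_comm]; exact Submodule.smul_mem _ _ hx

lemma IsRowBasis.exists_mat {W : FinSubspace K E} {n l k : ℕ}
    {w : Matrix (Fin l) (Fin n) (E ⊗[K] R)} (hw : IsRowBasis W w)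
    (x : Matrix (Fin k) (Fin n) (E ⊗[K] R)) (hx : ∀ a i, x a i ∈ tensorSub R W) :
    ∃ B : Matrix (Fin k) (Fin l) R, x = B.map (fun r => (1 : E) ⊗ₜ[K] r) * w := by
  choose r hr _ using fun a => hw.2 (x a) (hx a)
  refine ⟨r, ?_⟩
  ext a i
  rw [hr a i, Matrix.mul_apply]; rfl

lemma IsRowBasis.inj {W : FinSubspace K E} {n l k : ℕ}
    {w : Matrix (Fin l) (Fin n) (E ⊗[K] R)} (hw : IsRowBasis W w)
    (B C : Matrix (Fin k) (Fin l) R)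
    (h : B.map (fun r => (1 : E) ⊗ₜ[K] r) * w = C.map (fun r => (1 : E) ⊗ₜ[K] r) * w) :
    B = C := by
  ext1 a
  have hm : ∀ i, (B.map (fun r => (1 : E) ⊗ₜ[K] r) * w) a i ∈ tensorSub R W := by
    intro i
    rw [Matrix.mul_apply]
    exact sum_mem fun b _ => smul_mem W _ (hw.1 b i)
  exact congrFun ((hw.2 _ hm).unique (y₁ := B a) (y₂ := C a)
    (fun i => by rw [Matrix.mul_apply]; rfl) (fun i => by rw [h, Matrix.mul_apply]; rfl))

lemma exists_proj (W : FinSubspace K E) : ∃ ρ : E ⊗[K] R →ₗ[K] E ⊗[K] R,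
    (∀ x, ρ x ∈ tensorSub R W) ∧ (∀ x ∈ tensorSub R W, ρ x = x) ∧
    ∀ (r : R) x, ρ (((1 : E) ⊗ₜ[K] r) * x) = ((1 : E) ⊗ₜ[K] r) * ρ x := by
  obtain ⟨g, hg⟩ := W.1.subtype.exists_leftInverse_of_injective W.1.ker_subtype
  refine ⟨(W.1.subtype ∘ₗ g).rTensor R, ?_, ?_, ?_⟩
  · intro x
    rw [tensorSub_eq, LinearMap.rTensor_comp]
    exact ⟨_, rfl⟩
  · intro x hx
    rw [tensorSub_eq] at hx
    obtain ⟨y, rfl⟩ := hx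
    rw [← LinearMap.comp_apply, ← LinearMap.rTensor_comp, LinearMap.comp_assoc, hg]; rfl
  · intro r x
    induction x using TensorProduct.induction_on with
    | zero => simp
    | tmul w s => simp
    | add x y hx hy => simp [mul_add, hx, hy]

lemma map_mul' {a b c : ℕ} (P : Matrix (Fin a) (Fin b) R) (Q : Matrix (Fin b) (Fin c) R) :
    (P * Q).map (fun r => (1 : E) ⊗ₜ[K] r) =
      P.map (fun r => (1 : E) ⊗ₜ[K] r) * Q.map (fun r => (1 : E) ⊗ₜ[K] r) := by
  ext i j
  simp [Matrix.mul_apply, TensorProduct.tmul_sum]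

lemma represents_le {rk : MatrixFunction R} (hrk : IsSylvesterMatrixRank rk)
    (W : FinSubspace K E) {n m l p l' p' : ℕ} (A : Matrix (Fin n) (Fin m) (E ⊗[K] R))
    {B : Matrix (Fin l) (Fin p) R} {C : Matrix (Fin l') (Fin p') R}
    (hB : Represents W A B) (hC : Represents W A C) : rk _ _ B ≤ rk _ _ C := by
  obtain ⟨U, w, w', hU, hw, hw', h⟩ := hB
  obtain ⟨U2, v, v', hU2, hv, hv', h2⟩ := hC
  obtain ⟨Q, hQ⟩ := hw.exists_mat v hv.1
  obtain ⟨P, hP⟩ := hv.exists_mat w hw.1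
  obtain ⟨ρ, hρ1, hρ2, hρ3⟩ := exists_proj (R := R) U
  obtain ⟨D, hD⟩ := hw'.exists_mat (v'.map ρ) (fun a i => hρ1 _)
  -- `B w' = w A = P v A = P C v'`
  have e1 : B.map (fun r => (1 : E) ⊗ₜ[K] r) * w' =
      (P * C).map (fun r => (1 : E) ⊗ₜ[K] r) * v' := by
    rw [map_mul', Matrix.mul_assoc, ← h2, ← Matrix.mul_assoc, ← hP, h]
  have e2 : ∀ {k q : ℕ} (X : Matrix (Fin k) (Fin q) R) (y : Matrix (Fin q) (Fin m) (E ⊗[K] R)),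
      (X.map (fun r => (1 : E) ⊗ₜ[K] r) * y).map ρ =
        X.map (fun r => (1 : E) ⊗ₜ[K] r) * y.map ρ := by
    intro k q X y; ext i j; simp [Matrix.mul_apply, hρ3]
  have e3 : w'.map ρ = w' := by ext i j; simp [hρ2 _ (hw'.1 i j)]
  have e4 : B = P * C * D := by
    apply hw'.inj
    rw [map_mul', Matrix.mul_assoc, ← hD, ← e2, ← e1, e2, e3]
  rw [e4]
  exact ((hrk.mul_le _ _).trans (min_le_left _ _)).trans
    ((hrk.mul_le _ _).trans (min_le_right _ _))

lemma exists_represents (W : FinSubspace K E) {n m : ℕ}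
    (A : Matrix (Fin n) (Fin m) (E ⊗[K] R)) :
    ∃ (p : ℕ) (B : Matrix (Fin (n * dim W)) (Fin p) R), Represents W A B := by
  classical
  have fin : ∀ x : E ⊗[K] R, ∃ U : Submodule K E, FiniteDimensional K U ∧
      ∀ y ∈ tensorSub R W, y * x ∈ Submodule.span K {x | ∃ w ∈ U, ∃ r : R, x = w ⊗ₜ[K] r} := by
    intro x
    induction x using TensorProduct.induction_on with
    | zero => exact ⟨⊥, inferInstance, by simp⟩
    | tmul e r =>
      have := W.2.1
      refine ⟨W.1.map (LinearMap.mulRight K e), inferInstance, ?_⟩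
      intro y hy
      induction hy using Submodule.span_induction with
      | mem x h =>
        obtain ⟨w, hw, s, rfl⟩ := h
        exact Submodule.subset_span ⟨w * e, ⟨w, hw, rfl⟩, s * r, by simp⟩
      | zero => simp
      | add x y _ _ hx hy => rw [add_mul]; exact add_mem hx hy
      | smul c x _ hx => rw [smul_mul_assoc]; exact Submodule.smul_mem _ _ hx
    | add x y hx hy =>
      obtain ⟨U, hU, h1⟩ := hx
      obtain ⟨V, hV, h2⟩ := hy
      refine ⟨U ⊔ V, inferInstance, fun z hz => ?_⟩
      rw [mul_add]
      refine add_mem (Submodule.span_mono ?_ (h1 z hz)) (Submodule.span_mono ?_ (h2 z hz))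
      · rintro _ ⟨w, hw, r, rfl⟩; exact ⟨w, Submodule.mem_sup_left hw, r, rfl⟩
      · rintro _ ⟨w, hw, r, rfl⟩; exact ⟨w, Submodule.mem_sup_right hw, r, rfl⟩
  choose U hU h using fun i j => fin (A i j)
  have := W.2.1
  let T : FinSubspace K E := ⟨W.1 ⊔ ⨆ i, ⨆ j, U i j, inferInstance, fun h0 =>
    W.2.2 (by simpa using (sup_eq_bot_iff.1 h0).1)⟩
  have hT : ∀ i j, ∀ x ∈ tensorSub R W, x * A i j ∈ tensorSub R T := by
    intro i j x hx
    refine Submodule.span_mono ?_ (h i j x hx)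
    rintro _ ⟨w, hw, r, rfl⟩
    have hle : U i j ≤ W.1 ⊔ ⨆ i, ⨆ j, U i j :=
      le_sup_of_le_right (le_iSup_of_le i (le_iSup (U i) j))
    exact ⟨w, hle hw, r, rfl⟩
  obtain ⟨w, hw⟩ := exists_rowBasis (R := R) W n
  obtain ⟨w', hw'⟩ := exists_rowBasis (R := R) T m
  obtain ⟨B, hB⟩ := hw'.exists_mat (w * A) (fun a j => by
    rw [Matrix.mul_apply]
    exact sum_mem fun i _ => hT _ _ _ (hw.1 a i))
  exact ⟨_, B, T, w, w', hT, hw, hw', hB⟩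

/-- `rk_W(A)` is well defined. -/
theorem rankOn_eq {rk : MatrixFunction R} (hrk : IsSylvesterMatrixRank rk)
    (W : FinSubspace K E) {n m l p : ℕ} (A : Matrix (Fin n) (Fin m) (E ⊗[K] R))
    {B : Matrix (Fin l) (Fin p) R} (hB : Represents W A B) : rankOn rk W A = rk l p B := by
  have : {t | ∃ (l p : ℕ) (B : Matrix (Fin l) (Fin p) R), Represents W A B ∧ t = rk l p B} =
      {rk l p B} := by
    ext t
    constructor
    · rintro ⟨_, _, C, hC, rfl⟩
      exact le_antisymm (represents_le hrk W A hC hB) (represents_le hrk W A hB hC)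
    · rintro rfl; exact ⟨_, _, B, hB, rfl⟩
  rw [rankOn, this, csInf_singleton]

theorem rk_le {rk : MatrixFunction R} (hrk : IsSylvesterMatrixRank rk) :
    ∀ {l p : ℕ} (B : Matrix (Fin l) (Fin p) R), rk l p B ≤ l := by
  have h1 : ∀ l, rk l l 1 ≤ l := by
    intro l
    induction l with
    | zero => rw [Subsingleton.elim (1 : Matrix (Fin 0) (Fin 0) R) 0, hrk.map_zero]; simp
    | succ l ih =>
      have := hrk.diag (1 : Matrix (Fin l) (Fin l) R) (1 : Matrix (Fin 1) (Fin 1) R)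
      rw [Matrix.fromBlocks_one, hrk.map_one] at this
      simp at this
      rw [this]; push_cast; linarith
  intro l p B
  calc _ = rk l p ((1 : Matrix (Fin l) (Fin l) R) * B) := by rw [Matrix.one_mul]
    _ ≤ _ := ((hrk.mul_le _ _).trans (min_le_left _ _)).trans (h1 l)

/-- The limit defining the extension exists. -/
theorem tendsto_rankExt {rk : MatrixFunction R} (hrk : IsSylvesterMatrixRank rk)
    (ω : Ultrafilter (FinSubspace K E)) {n m : ℕ} (A : Matrix (Fin n) (Fin m) (E ⊗[K] R)) :
    Filter.Tendsto (fun W => rankOn rk W A / (dim W : ℝ)) ω (nhds (rankExt rk ω n m A)) := by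
  have hb : ∀ W : FinSubspace K E, rankOn rk W A / (dim W : ℝ) ∈ Set.Icc (0 : ℝ) n := by
    intro W
    obtain ⟨p, B, hB⟩ := exists_represents W A
    rw [rankOn_eq hrk W A hB]
    refine ⟨div_nonneg (hrk.nonneg _) (by positivity), ?_⟩
    have := rk_le hrk B
    push_cast at this
    exact div_le_of_le_mul₀ (by positivity) (by positivity) this
  obtain ⟨x, -, hx⟩ := isCompact_Icc.ultrafilter_le_nhds
    (ω.map fun W => rankOn rk W A / (dim W : ℝ)) 
      (Filter.le_principal_iff.2 (Filter.mem_map.2 (Filter.univ_mem' hb)))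
  exact tendsto_nhds_limUnder ⟨x, hx⟩

end FieldExt

/-!
The extension of `rk` from `R` to `E ⊗ R` is a limit of normalized ranks `rk_W(A) / dim W`, and the
whole statement rests on the fact that this limit does not depend on the non-principal ultrafilter.

*Coordinates.* `E ⊗ R` is a free left `R`-module. The rank `famRank` of a finite family of vectors
in a free left `R`-module, defined through coordinates, is monotone in the span, does not increase
under linear maps, and is subadditive. If `e` is a finite family spanning `W` over `K`, then
`rk_W(A)` is the rank of the family of all vectors `e b • A i` with `A i` a row of `A`
(`rankOn_eq_tupRank`).
So `W ↦ rk_W(A)` is monotone, subadditive, bounded by a multiple of the dimension, and invariant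
under multiplication of `W` by nonzero elements of `E`.

*Independence of the ultrafilter.* If `dim U + dim F ≤ dim W`, then some `x ∈ W` satisfies
`x F ∩ U = 0` (`exists_disjoint_translate`). For finite `K` this is a counting argument. For
infinite `K`, choose `x ∈ W` such that the map `F → E / U`, `y ↦ x y`, has the largest rank; if it
kills some `y ≠ 0`, a determinant argument gives `W y ⊆ U + x F`, which is too small. Hence an
almost invariant `W` is tiled by translates of any given `F`, up to a small error, and
`lim rk_W(A) / dim W ≤ rk_F(A) / dim F` for every `F` if `E / K` is infinite. The limit is therefore
the infimum (`IsInvariantSubadditive.limit_le`). If `E / K` is finite, the only non-principal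
ultrafilter is the principal one at `E`.

*The Sylvester axioms* hold on each `W` exactly, except `rk(A B) ≤ rk(B)`, which holds up to an
error that almost invariance makes negligible. Non-principal ultrafilters exist because the powers
of a finite-dimensional subspace of a field have polynomially bounded dimension.

*Transitivity.* If `u` is an `E`-basis of `U ⊆ E'` and `W ⊆ E`, then the rank over `R` of `A` on the
product `W u` is the rank on `W` of a matrix over `E ⊗ R` that represents `A` on `U`
(`exists_rankOn_prodSub`), and `W u` is almost invariant if `U` and `W` are
(`isInvariant_prodSub`). So the iterated extension is the extension of `rk` along the non-principal
ultrafilter obtained by letting first `W` and then `U` run to the limit, and by independence of the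
ultrafilter it equals `rk_{E'/K}`.
-/

/-! ### Ranks of matrices with arbitrary finite index types -/

section FintypeIndexed

variable {R : Type*} [Ring R]

/-- The value of `rk` on a matrix whose rows and columns are indexed by arbitrary finite types,
enumerated in an unspecified order (the order does not matter, see `rankF_eq`). -/
noncomputable def rankF (rk : MatrixFunction R) {κ μ : Type*} [Fintype κ] [Fintype μ]
    (A : Matrix κ μ R) : ℝ :=
  rk (Fintype.card κ) (Fintype.card μ)
    (Matrix.reindex (Fintype.equivFin κ) (Fintype.equivFin μ) A)

variable {rk : MatrixFunction R} (hrk : IsSylvesterMatrixRank rk)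
include hrk

theorem IsSylvesterMatrixRank.submatrix_le {n m n' m' : ℕ} (A : Matrix (Fin n) (Fin m) R)
    (f : Fin n' → Fin n) (g : Fin m' ≃ Fin m) : rk n' m' (A.submatrix f g) ≤ rk n m A := by
  classical
  have : A.submatrix f g =
      (1 : Matrix (Fin n) (Fin n) R).submatrix f id *
        (A * (1 : Matrix (Fin m) (Fin m) R).submatrix id g) := by
    ext i j
    simp [Matrix.mul_apply, Matrix.one_apply]
  rw [this]
  exact ((hrk.mul_le _ _).trans (min_le_right _ _)).trans
    ((hrk.mul_le _ _).trans (min_le_left _ _))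

theorem rankF_eq {κ μ : Type*} [Fintype κ] [Fintype μ] {n m : ℕ} (e : κ ≃ Fin n) (f : μ ≃ Fin m)
    (A : Matrix κ μ R) : rankF rk A = rk n m (Matrix.reindex e f A) := by
  have h1 : Matrix.reindex (Fintype.equivFin κ) (Fintype.equivFin μ) A =
      (Matrix.reindex e f A).submatrix ((Fintype.equivFin κ).symm.trans e)
        ((Fintype.equivFin μ).symm.trans f) := by
    ext i j; simp
  have h2 : Matrix.reindex e f A =
      (Matrix.reindex (Fintype.equivFin κ) (Fintype.equivFin μ) A).submatrix
        (e.symm.trans (Fintype.equivFin κ)) (f.symm.trans (Fintype.equivFin μ)) := by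
    ext i j; simp
  apply le_antisymm
  · rw [rankF, h1]; exact hrk.submatrix_le _ _ _
  · rw [h2]; exact hrk.submatrix_le _ _ _

theorem rankF_fin {n m : ℕ} (A : Matrix (Fin n) (Fin m) R) : rankF rk A = rk n m A := by
  rw [rankF_eq hrk (Equiv.refl _) (Equiv.refl _)]; simp

theorem rankF_nonneg {κ μ : Type*} [Fintype κ] [Fintype μ] (A : Matrix κ μ R) :
    0 ≤ rankF rk A := hrk.nonneg _

theorem rankF_zero {κ μ : Type*} [Fintype κ] [Fintype μ] :
    rankF rk (0 : Matrix κ μ R) = 0 := hrk.map_zero _ _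

theorem rankF_mul_le {κ μ ν : Type*} [Fintype κ] [Fintype μ] [Fintype ν]
    (A : Matrix κ μ R) (B : Matrix μ ν R) :
    rankF rk (A * B) ≤ min (rankF rk A) (rankF rk B) := by
  unfold rankF
  convert hrk.mul_le (Matrix.reindex (Fintype.equivFin κ) (Fintype.equivFin μ) A)
    (Matrix.reindex (Fintype.equivFin μ) (Fintype.equivFin ν) B) using 2
  simp [Matrix.submatrix_mul_equiv]

theorem rankF_mul_le_left {κ μ ν : Type*} [Fintype κ] [Fintype μ] [Fintype ν]
    (A : Matrix κ μ R) (B : Matrix μ ν R) : rankF rk (A * B) ≤ rankF rk A :=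
  (rankF_mul_le hrk A B).trans (min_le_left _ _)

theorem rankF_mul_le_right {κ μ ν : Type*} [Fintype κ] [Fintype μ] [Fintype ν]
    (A : Matrix κ μ R) (B : Matrix μ ν R) : rankF rk (A * B) ≤ rankF rk B :=
  (rankF_mul_le hrk A B).trans (min_le_right _ _)

theorem rankF_fromBlocks_diag {κ μ κ' μ' : Type*} [Fintype κ] [Fintype μ] [Fintype κ']
    [Fintype μ'] (A : Matrix κ μ R) (B : Matrix κ' μ' R) :
    rankF rk (Matrix.fromBlocks A 0 0 B) = rankF rk A + rankF rk B := by
  rw [rankF_eq hrk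
    ((Equiv.sumCongr (Fintype.equivFin κ) (Fintype.equivFin κ')).trans finSumFinEquiv)
    ((Equiv.sumCongr (Fintype.equivFin μ) (Fintype.equivFin μ')).trans finSumFinEquiv)]
  unfold rankF
  rw [← hrk.diag]
  congr 1
  ext i j
  obtain ⟨i, rfl⟩ := finSumFinEquiv.surjective i
  obtain ⟨j, rfl⟩ := finSumFinEquiv.surjective j
  cases i <;> cases j <;> simp

theorem rankF_fromBlocks_triangular {κ μ κ' μ' : Type*} [Fintype κ] [Fintype μ] [Fintype κ']
    [Fintype μ'] (A : Matrix κ μ R) (B : Matrix κ' μ' R) (C : Matrix κ μ' R) :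
    rankF rk A + rankF rk B ≤ rankF rk (Matrix.fromBlocks A C 0 B) := by
  rw [rankF_eq hrk (A := Matrix.fromBlocks A C 0 B)
    ((Equiv.sumCongr (Fintype.equivFin κ) (Fintype.equivFin κ')).trans finSumFinEquiv)
    ((Equiv.sumCongr (Fintype.equivFin μ) (Fintype.equivFin μ')).trans finSumFinEquiv)]
  unfold rankF
  refine (hrk.triangular _ _
    (Matrix.reindex (Fintype.equivFin κ) (Fintype.equivFin μ') C)).trans_eq ?_
  congr 1
  ext i j
  obtain ⟨i, rfl⟩ := finSumFinEquiv.surjective i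
  obtain ⟨j, rfl⟩ := finSumFinEquiv.surjective j
  cases i <;> cases j <;> simp

theorem rk_one_fin (n : ℕ) : rk n n 1 = n := by
  induction n with
  | zero => rw [Subsingleton.elim (1 : Matrix (Fin 0) (Fin 0) R) 0, hrk.map_zero]; simp
  | succ l ih =>
    have := hrk.diag (1 : Matrix (Fin l) (Fin l) R) (1 : Matrix (Fin 1) (Fin 1) R)
    rw [Matrix.fromBlocks_one, hrk.map_one] at this
    simp at this
    rw [this, ih]; push_cast; rfl

theorem rankF_one {κ : Type*} [Fintype κ] [DecidableEq κ] :
    rankF rk (1 : Matrix κ κ R) = Fintype.card κ := by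
  rw [rankF, ← rk_one_fin hrk]
  simp

theorem rankF_le_card {κ μ : Type*} [Fintype κ] [Fintype μ] (A : Matrix κ μ R) :
    rankF rk A ≤ Fintype.card κ := FieldExt.rk_le hrk _

theorem IsSylvesterMatrixRank.nontrivial : Nontrivial R := by
  by_contra h
  rw [not_nontrivial_iff_subsingleton] at h
  have := hrk.map_one
  rw [Subsingleton.elim (1 : Matrix (Fin 1) (Fin 1) R) 0, hrk.map_zero] at this
  exact zero_ne_one this

end FintypeIndexed

/-! ### The rank of a finite family of vectors in a free module -/

section Family

open Module

variable {R : Type*} [Ring R]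

open Classical in
/-- The rank of a finite family `v` of vectors in a free left `R`-module: the rank of its matrix of
coordinates with respect to a basis. Only the finitely many basis vectors that occur in `v` are used
as columns; any other basis gives the same value, see `famRank_eq`. -/
noncomputable def famRank (rk : MatrixFunction R) {N : Type*} [AddCommGroup N] [Module R N]
    [Module.Free R N] {κ : Type*} [Fintype κ] (v : κ → N) : ℝ :=
  rankF rk (Matrix.of fun (k : κ)
    (j : ↥(Finset.univ.biUnion fun k => ((Free.chooseBasis R N).repr (v k)).support)) =>
      (Free.chooseBasis R N).repr (v k) j)

variable {N N' : Type*} [AddCommGroup N] [Module R N] [Module.Free R N]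
  [AddCommGroup N'] [Module R N'] [Module.Free R N']
  {κ κ' : Type*} [Fintype κ] [Fintype κ']

/-- `φ` gives coordinates with respect to the finite family `e`, which is then a basis of a free
direct summand. -/
def IsCoord {β : Type*} [Fintype β] (e : β → N) (φ : N →ₗ[R] (β → R)) : Prop :=
  ∀ c : β → R, φ (∑ b, c b • e b) = c

omit [Module.Free R N] in
theorem IsCoord.of_single {β : Type*} [Fintype β] [DecidableEq β] {e : β → N}
    {φ : N →ₗ[R] (β → R)} (h : ∀ b, φ (e b) = Pi.single b 1) : IsCoord e φ := by
  intro c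
  rw [_root_.map_sum]
  simp only [map_smul, h]
  ext a
  simp [Finset.sum_apply, Pi.single_apply]

/-- Every finite family `v` has the form `B e` with `e` a basis of a free direct summand, and the
rank of `v` is that of `B`. -/
theorem exists_coord_matrix (rk : MatrixFunction R) (v : κ → N) :
    ∃ (β : Finset (Free.ChooseBasisIndex R N)) (e : β → N) (φ : N →ₗ[R] (β → R))
      (B : Matrix κ β R), IsCoord e φ ∧ (∀ k, v k = ∑ b, B k b • e b) ∧
        famRank rk v = rankF rk B := by
  classical
  set b := Free.chooseBasis R N
  set s := Finset.univ.biUnion fun k => (b.repr (v k)).support with hs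
  refine ⟨s, fun j => b j, LinearMap.pi fun j => b.coord j,
    Matrix.of fun k j => b.repr (v k) j, ?_, ?_, rfl⟩
  · apply IsCoord.of_single
    intro j
    ext i
    rw [LinearMap.pi_apply, Basis.coord_apply, Basis.repr_self, Finsupp.single_apply,
      Pi.single_apply]
    simp only [Subtype.ext_iff, eq_comm]
  · intro k
    conv_lhs => rw [← b.linearCombination_repr (v k)]
    rw [Finsupp.linearCombination_apply, Finsupp.sum_of_support_subset (s := s)]
    · exact (Finset.sum_coe_sort s fun j => b.repr (v k) j • b j).symm
    · intro j hj
      exact Finset.mem_biUnion.2 ⟨k, Finset.mem_univ _, hj⟩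
    · simp

omit [Module.Free R N] [Fintype κ] in
/-- If `v = P u`, then the matrix of coordinates of `v` is `P` times that of `u`. -/
theorem coord_eq_mul {β γ : Type*} [Fintype β] [Fintype γ] {v : κ → N} {u : γ → N}
    (P : Matrix κ γ R) (h : ∀ k, v k = ∑ c, P k c • u c) (φ : N →ₗ[R] (β → R)) :
    (Matrix.of fun k => φ (v k)) = P * Matrix.of fun c => φ (u c) := by
  ext k b
  rw [Matrix.of_apply, h, map_sum, Finset.sum_apply, Matrix.mul_apply]
  simp

variable {rk : MatrixFunction R} (hrk : IsSylvesterMatrixRank rk)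
include hrk

theorem famRank_le_rankF {β : Type*} [Fintype β] {v : κ → N} (e : β → N) (B : Matrix κ β R)
    (h : ∀ k, v k = ∑ b, B k b • e b) : famRank rk v ≤ rankF rk B := by
  obtain ⟨γ, e', φ, C, h1, h2, h3⟩ := exists_coord_matrix rk v
  rw [h3]
  have : C = Matrix.of fun k => φ (v k) := by
    funext k
    change C k = φ (v k)
    rw [h2, h1]
  rw [this, coord_eq_mul B h]
  exact rankF_mul_le_left hrk _ _

theorem famRank_eq {β : Type*} [Fintype β] {v : κ → N} {e : β → N} {φ : N →ₗ[R] (β → R)}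
    (hφ : IsCoord e φ) (B : Matrix κ β R) (h : ∀ k, v k = ∑ b, B k b • e b) :
    famRank rk v = rankF rk B := by
  apply le_antisymm (famRank_le_rankF hrk e B h)
  obtain ⟨γ, e', φ', C, h1, h2, h3⟩ := exists_coord_matrix rk v
  have : B = Matrix.of fun k => φ (v k) := by
    funext k
    change B k = φ (v k)
    rw [h, hφ]
  rw [h3, this, coord_eq_mul C h2]
  exact rankF_mul_le_left hrk _ _

theorem famRank_nonneg (v : κ → N) : 0 ≤ famRank rk v := rankF_nonneg hrk _

theorem famRank_le_card (v : κ → N) : famRank rk v ≤ Fintype.card κ := rankF_le_card hrk _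

theorem famRank_zero : famRank rk (0 : κ → N) = 0 := by
  apply le_antisymm _ (famRank_nonneg hrk _)
  rw [← rankF_zero hrk (κ := κ) (μ := Empty)]
  exact famRank_le_rankF hrk Empty.elim _ (by simp)

/-- The rank of a family is monotone in its `R`-span. -/
theorem famRank_mono {v : κ → N} {u : κ' → N} (h : ∀ k, v k ∈ Submodule.span R (Set.range u)) :
    famRank rk v ≤ famRank rk u := by
  obtain ⟨γ, e, φ, C, h1, h2, h3⟩ := exists_coord_matrix rk u
  choose P hP using fun k => (Submodule.mem_span_range_iff_exists_fun R).1 (h k)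
  rw [h3]
  refine (famRank_le_rankF hrk e (Matrix.of P * C) fun k => ?_).trans (rankF_mul_le_right hrk _ _)
  rw [← hP]
  simp only [h2, Matrix.mul_apply, Finset.smul_sum, Finset.sum_smul, Matrix.of_apply, mul_smul]
  rw [Finset.sum_comm]

theorem famRank_map_le (φ : N →ₗ[R] N') (v : κ → N) :
    famRank rk (fun k => φ (v k)) ≤ famRank rk v := by
  obtain ⟨γ, e, -, C, -, h2, h3⟩ := exists_coord_matrix rk v
  rw [h3]
  exact famRank_le_rankF hrk (fun c => φ (e c)) C fun k => by simp [h2]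

theorem famRank_map_eq (φ : N →ₗ[R] N') (ψ : N' →ₗ[R] N) (h : ∀ x, ψ (φ x) = x) (v : κ → N) :
    famRank rk (fun k => φ (v k)) = famRank rk v := by
  apply le_antisymm (famRank_map_le hrk φ v)
  simpa [h] using famRank_map_le hrk ψ (fun k => φ (v k))

theorem famRank_sumElim_le (v : κ → N) (u : κ' → N) :
    famRank rk (Sum.elim v u) ≤ famRank rk v + famRank rk u := by
  classical
  obtain ⟨γ, e, φ, C, h1, h2, h3⟩ := exists_coord_matrix rk v
  obtain ⟨δ, f, ψ, D, k1, k2, k3⟩ := exists_coord_matrix rk u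
  rw [h3, k3, ← rankF_fromBlocks_diag hrk]
  apply famRank_le_rankF hrk (Sum.elim e f)
  rintro (k | k) <;> simp [h2, k2]

/-- A block triangular family has rank at least the sum of the ranks of the diagonal blocks. -/
theorem famRank_triangular (v : κ → N) (c : κ → N') (u : κ' → N') :
    famRank rk v + famRank rk u ≤
      famRank rk (Sum.elim (fun k => (v k, c k)) (fun k => ((0 : N), u k))) := by
  classical
  obtain ⟨γ, e, φ, C, h1, h2, h3⟩ := exists_coord_matrix rk v
  obtain ⟨δ, f, ψ, D, k1, k2, k3⟩ := exists_coord_matrix rk (Sum.elim c u)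
  set X : Matrix (κ ⊕ κ') (γ ⊕ δ) R :=
    Matrix.fromBlocks C (D.submatrix Sum.inl id) 0 (D.submatrix Sum.inr id)
  have hX : famRank rk (Sum.elim (fun k => (v k, c k)) (fun k => ((0 : N), u k))) =
      rankF rk X := by
    apply famRank_eq hrk (e := Sum.elim (fun a => (e a, (0 : N'))) (fun a => ((0 : N), f a)))
      (φ := (LinearEquiv.sumArrowLequivProdArrow γ δ R R).symm.toLinearMap ∘ₗ φ.prodMap ψ)
    · intro a
      have e1 := h1 (fun i => a (Sum.inl i))
      have e2 := k1 (fun i => a (Sum.inr i))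
      simp only [Fintype.sum_sum_type, Sum.elim_inl, Sum.elim_inr, Prod.smul_mk, smul_zero]
      ext (i | i)
      · simpa [Prod.fst_sum] using congrFun e1 i
      · simpa [Prod.snd_sum] using congrFun e2 i
    · rintro (k | k)
      · have := k2 (Sum.inl k)
        simp only [Sum.elim_inl] at this
        ext
        · simp [X, h2, Prod.fst_sum]
        · simp [X, this, Prod.snd_sum]
      · have := k2 (Sum.inr k)
        simp only [Sum.elim_inr] at this
        ext
        · simp [X, Prod.fst_sum]
        · simp [X, this, Prod.snd_sum]
  have hu : famRank rk u = rankF rk (D.submatrix Sum.inr id) :=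
    famRank_eq hrk k1 _ fun k => k2 (Sum.inr k)
  rw [hX, hu, h3]
  exact rankF_fromBlocks_triangular hrk _ _ _

end Family

/-! ### `E ⊗ R` as a free left `R`-module -/

namespace FieldExt

open Module

section CoeffModule

variable {K E R : Type*} [Field K] [Field E] [Algebra K E] [Ring R] [Algebra K R]

/-- The left `R`-module structure on `E ⊗ R` in which `r` acts as left multiplication by
`1 ⊗ r`. -/
@[reducible] noncomputable def coeffModule : Module R (E ⊗[K] R) :=
  Module.compHom _ (Algebra.TensorProduct.includeRight : R →ₐ[K] E ⊗[K] R).toRingHom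

attribute [local instance] coeffModule

theorem coeff_smul_def (r : R) (x : E ⊗[K] R) : r • x = ((1 : E) ⊗ₜ[K] r) * x := rfl

instance : IsScalarTower R (E ⊗[K] R) (E ⊗[K] R) :=
  ⟨fun r x y => by simp only [coeff_smul_def, smul_eq_mul, mul_assoc]⟩

instance : SMulCommClass R E (E ⊗[K] R) :=
  ⟨fun r x y => by simp only [coeff_smul_def, mul_smul_comm]⟩

instance : SMulCommClass E R (E ⊗[K] R) := SMulCommClass.symm _ _ _

theorem coeff_smul_tmul (r : R) (x : E) (s : R) : r • (x ⊗ₜ[K] s) = x ⊗ₜ[K] (r * s) := by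
  rw [coeff_smul_def, Algebra.TensorProduct.tmul_mul_tmul, one_mul]

theorem tmul_one_mul (x : E) (y : E ⊗[K] R) : (x ⊗ₜ[K] (1 : R)) * y = x • y := by
  rw [Algebra.smul_def, Algebra.TensorProduct.algebraMap_apply, Algebra.algebraMap_self_apply]

variable (K E R) in
/-- The flip `R ⊗ E ≃ E ⊗ R` is linear for the left action of `R`. -/
noncomputable def flipEquiv : R ⊗[K] E ≃ₗ[R] E ⊗[K] R :=
  { TensorProduct.comm K R E with
    map_smul' := fun r x => by
      induction x using TensorProduct.induction_on with
      | zero => simp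
      | tmul s y =>
        simp only [AddHom.toFun_eq_coe, LinearMap.coe_toAddHom, LinearEquiv.coe_coe,
          TensorProduct.smul_tmul', TensorProduct.comm_tmul, RingHom.id_apply, coeff_smul_tmul,
          smul_eq_mul]
      | add x y hx hy =>
        rw [smul_add]
        simp only [AddHom.toFun_eq_coe, map_add] at *
        rw [hx, hy, ← smul_add] }

instance : Module.Free R (E ⊗[K] R) :=
  Module.Free.of_basis ((Algebra.TensorProduct.basis R (Basis.ofVectorSpace K E)).map
    (flipEquiv K E R))

/-- Linearly independent elements of `E` span a free direct summand of `E ⊗ R`. -/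
theorem exists_isCoord_tmul {β : Type*} [Fintype β] {e : β → E} (he : LinearIndependent K e) :
    ∃ φ : E ⊗[K] R →ₗ[R] (β → R), IsCoord (fun b => e b ⊗ₜ[K] (1 : R)) φ := by
  classical
  obtain ⟨g, hg⟩ := (Fintype.linearCombination K e).exists_leftInverse_of_injective
    (LinearMap.ker_eq_bot.2
      (linearIndependent_iff_injective_fintypeLinearCombination.1 he))
  have hge : ∀ b, g (e b) = Pi.single b 1 := fun b => by
    have := LinearMap.congr_fun hg (Pi.single b 1)
    simpa [Fintype.linearCombination_apply_single] using this
  let h : β → E ⊗[K] R →ₗ[K] R := fun b =>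
    (TensorProduct.lid K R).toLinearMap ∘ₗ ((LinearMap.proj b ∘ₗ g).rTensor R)
  have hh : ∀ b x r, h b (x ⊗ₜ r) = g x b • r := fun b x r => by simp [h]
  let φ : E ⊗[K] R →ₗ[R] (β → R) := LinearMap.pi fun b =>
    { h b with
      map_smul' := fun r x => by
        induction x using TensorProduct.induction_on with
        | zero => simp
        | tmul y s => simp [coeff_smul_tmul, hh]
        | add x y hx hy =>
          rw [smul_add]
          simp only [AddHom.toFun_eq_coe, map_add] at *
          rw [hx, hy, ← smul_add] }
  refine ⟨φ, IsCoord.of_single fun b => ?_⟩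
  ext c
  change h c (e b ⊗ₜ 1) = _
  rw [hh, hge]
  simp [Pi.single_apply]

/-- A row basis of `(W ⊗ R)ⁿ` is a basis of a direct summand of `(E ⊗ R)ⁿ`, since `W ⊗ R` is a
direct summand of `E ⊗ R`. -/
theorem IsRowBasis.exists_isCoord {W : FinSubspace K E} {n l : ℕ}
    {w : Matrix (Fin l) (Fin n) (E ⊗[K] R)} (hw : IsRowBasis W w) :
    ∃ φ : (Fin n → E ⊗[K] R) →ₗ[R] (Fin l → R), IsCoord w φ := by
  obtain ⟨ρ, h1, h2, h3⟩ := exists_proj (R := R) W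
  choose c hc hu using fun x : Fin n → E ⊗[K] R => hw.2 (fun i => ρ (x i)) (fun i => h1 _)
  refine ⟨{ toFun := c, map_add' := fun x y => ?_, map_smul' := fun r x => ?_ }, fun r => ?_⟩
  · refine (hu _ _ fun i => ?_).symm
    dsimp only [Pi.add_apply]
    rw [map_add, hc x i, hc y i, ← Finset.sum_add_distrib]
    simp only [TensorProduct.tmul_add, add_mul]
  · refine (hu _ _ fun i => ?_).symm
    dsimp only [Pi.smul_apply, RingHom.id_apply]
    rw [coeff_smul_def, h3, hc x i, Finset.mul_sum]
    simp only [smul_eq_mul, ← mul_assoc, Algebra.TensorProduct.tmul_mul_tmul, one_mul]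
  · refine (hu _ _ fun i => ?_).symm
    rw [Finset.sum_apply, h2]
    · rfl
    · exact sum_mem fun a _ => smul_mem W _ (hw.1 a i)

theorem mem_span_of_mem_tensorSub {β : Type*} [Fintype β] {e : β → E} {W : FinSubspace K E}
    (h : W.1 ≤ Submodule.span K (Set.range e)) {x : E ⊗[K] R} (hx : x ∈ tensorSub R W) :
    x ∈ Submodule.span R (Set.range fun b => e b ⊗ₜ[K] (1 : R)) := by
  induction hx using Submodule.span_induction with
  | mem x hx =>
    obtain ⟨w, hw, r, rfl⟩ := hx
    obtain ⟨c, rfl⟩ := (Submodule.mem_span_range_iff_exists_fun K).1 (h hw)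
    rw [TensorProduct.sum_tmul]
    refine Submodule.sum_mem _ fun b _ => ?_
    have : (c b • e b) ⊗ₜ[K] r = (c b • r) • (e b ⊗ₜ[K] (1 : R)) := by
      rw [coeff_smul_tmul, mul_one, TensorProduct.smul_tmul]
    rw [this]
    exact Submodule.smul_mem _ _ (Submodule.subset_span ⟨b, rfl⟩)
  | zero => exact zero_mem _
  | add x y _ _ hx hy => exact add_mem hx hy
  | smul c x _ hx =>
    have : c • x = (algebraMap K R c) • x := by
      rw [coeff_smul_def, Algebra.smul_def, Algebra.TensorProduct.algebraMap_apply,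
        Algebra.algebraMap_eq_smul_one, Algebra.algebraMap_eq_smul_one, TensorProduct.smul_tmul]
    rw [this]
    exact Submodule.smul_mem _ _ hx

/-- The rank over `R` of the family of all products `e b • A i` of the elements `e b` of `E` and the
rows of `A`. If `e` spans `W` over `K`, this is `rk_W(A)`. -/
noncomputable def tupRank (rk : MatrixFunction R) {β ν μ : Type*} [Fintype β] [Fintype ν]
    [Fintype μ] (e : β → E) (A : Matrix ν μ (E ⊗[K] R)) : ℝ :=
  famRank rk fun p : ν × β => fun j => e p.2 • A p.1 j

theorem rankOn_eq_tupRank {rk : MatrixFunction R} (hrk : IsSylvesterMatrixRank rk)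
    {β : Type*} [Fintype β] {e : β → E} {W : FinSubspace K E}
    (he : Submodule.span K (Set.range e) = W.1) {n m : ℕ}
    (A : Matrix (Fin n) (Fin m) (E ⊗[K] R)) : rankOn rk W A = tupRank rk e A := by
  classical
  obtain ⟨p, B, hB⟩ := exists_represents W A
  rw [rankOn_eq hrk W A hB]
  obtain ⟨W', w, w', hW', hw, hw', h⟩ := hB
  obtain ⟨φ, hφ⟩ := hw'.exists_isCoord
  rw [← rankF_fin hrk, ← famRank_eq hrk (v := fun a => (w * A) a) hφ B fun a => by
    ext j
    rw [h, Matrix.mul_apply, Finset.sum_apply]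
    rfl]
  -- right multiplication of rows by `A`
  let T : (Fin n → E ⊗[K] R) →ₗ[R] (Fin m → E ⊗[K] R) :=
    { toFun := fun x => Matrix.vecMul x A
      map_add' := fun x y => Matrix.add_vecMul _ _ _
      map_smul' := fun r x => Matrix.smul_vecMul _ _ _ }
  have hT : ∀ i b, (fun j => e b • A i j) = T (Pi.single i (e b ⊗ₜ[K] (1 : R))) := by
    intro i b
    ext j
    simp only [T, LinearMap.coe_mk, AddHom.coe_mk, Matrix.single_vecMul, Matrix.row]
    exact (tmul_one_mul _ _).symm
  apply le_antisymm
  · apply famRank_mono hrk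
    intro a
    have h1 : w a ∈ Submodule.span R
        (Set.range fun p : Fin n × β =>
          Pi.single (M := fun _ => E ⊗[K] R) p.1 (e p.2 ⊗ₜ[K] (1 : R))) := by
      rw [← Finset.univ_sum_single (w a)]
      refine Submodule.sum_mem _ fun i _ => ?_
      have := Submodule.mem_map_of_mem (f := LinearMap.single R (fun _ : Fin n => E ⊗[K] R) i)
        (mem_span_of_mem_tensorSub he.ge (hw.1 a i))
      rw [Submodule.map_span] at this
      refine Submodule.span_mono ?_ this
      rintro _ ⟨_, ⟨b, rfl⟩, rfl⟩
      exact ⟨(i, b), rfl⟩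
    have h2 := Submodule.mem_map_of_mem (f := T) h1
    rw [Submodule.map_span, ← Set.range_comp] at h2
    have h3 : (fun (p : Fin n × β) (j : Fin m) => e p.2 • A p.1 j) =
        T ∘ fun p : Fin n × β =>
          Pi.single (M := fun _ => E ⊗[K] R) p.1 (e p.2 ⊗ₜ[K] (1 : R)) :=
      funext fun p => hT p.1 p.2
    rw [h3]
    exact h2
  · apply famRank_mono hrk
    rintro ⟨i, b⟩
    obtain ⟨r, hr, -⟩ := hw.2 (Pi.single i (e b ⊗ₜ[K] (1 : R))) fun i' => by
      rw [Pi.single_apply]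
      split_ifs
      · exact Submodule.subset_span ⟨_, he.le (Submodule.subset_span ⟨b, rfl⟩), 1, rfl⟩
      · exact zero_mem _
    have hr' : Pi.single i (e b ⊗ₜ[K] (1 : R)) = ∑ a, r a • w a := by
      ext i'
      rw [hr, Finset.sum_apply]
      rfl
    have hTs : (fun j => e b • A i j) = ∑ a, r a • T (w a) := by
      rw [hT, hr', _root_.map_sum]
      simp only [map_smul]
    refine Set.mem_of_eq_of_mem hTs ?_
    exact Submodule.sum_mem _ fun a _ => Submodule.smul_mem _ _ (Submodule.subset_span ⟨a, rfl⟩)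

section tupRank

variable {rk : MatrixFunction R} (hrk : IsSylvesterMatrixRank rk)
  {β β' ν ν' μ μ' : Type*} [Fintype β] [Fintype β'] [Fintype ν] [Fintype ν'] [Fintype μ]
  [Fintype μ']
include hrk

theorem tupRank_mono {e : β → E} {e' : β' → E} (h : ∀ b, e b ∈ Submodule.span K (Set.range e'))
    (A : Matrix ν μ (E ⊗[K] R)) : tupRank rk e A ≤ tupRank rk e' A := by
  apply famRank_mono hrk
  rintro ⟨i, b⟩
  obtain ⟨c, hc⟩ := (Submodule.mem_span_range_iff_exists_fun K).1 (h b)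
  have : (fun j => e b • A i j) = ∑ b', algebraMap K R (c b') • fun j => e' b' • A i j := by
    ext j
    rw [← hc, Finset.sum_apply, Finset.sum_smul]
    refine Finset.sum_congr rfl fun b' _ => ?_
    rw [Pi.smul_apply, smul_assoc, coeff_smul_def, Algebra.smul_def,
      Algebra.TensorProduct.algebraMap_apply,
        Algebra.algebraMap_eq_smul_one, Algebra.algebraMap_eq_smul_one, TensorProduct.smul_tmul]
  dsimp only
  rw [this]
  exact Submodule.sum_mem _ fun b' _ =>
    Submodule.smul_mem _ _ (Submodule.subset_span ⟨(i, b'), rfl⟩)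

theorem tupRank_nonneg (e : β → E) (A : Matrix ν μ (E ⊗[K] R)) : 0 ≤ tupRank rk e A :=
  famRank_nonneg hrk _

theorem tupRank_le (e : β → E) (A : Matrix ν μ (E ⊗[K] R)) :
    tupRank rk e A ≤ Fintype.card ν * Fintype.card β :=
  (famRank_le_card hrk _).trans_eq (by simp)

theorem tupRank_smul_le (x : E) (e : β → E) (A : Matrix ν μ (E ⊗[K] R)) :
    tupRank rk (fun b => x * e b) A ≤ tupRank rk e A := by
  let T : (μ → E ⊗[K] R) →ₗ[R] (μ → E ⊗[K] R) :=
    { toFun := fun y => x • y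
      map_add' := fun y z => smul_add _ _ _
      map_smul' := fun r y => smul_comm _ _ _ }
  refine le_of_eq_of_le ?_ (famRank_map_le hrk T _)
  unfold tupRank
  congr 1
  ext p j
  exact mul_smul _ _ _

theorem tupRank_sumElim_le (e : β → E) (e' : β' → E) (A : Matrix ν μ (E ⊗[K] R)) :
    tupRank rk (Sum.elim e e') A ≤ tupRank rk e A + tupRank rk e' A := by
  refine le_trans ?_ (famRank_sumElim_le hrk _ _)
  apply famRank_mono hrk
  rintro ⟨i, b | b⟩
  · exact Submodule.subset_span ⟨Sum.inl (i, b), rfl⟩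
  · exact Submodule.subset_span ⟨Sum.inr (i, b), rfl⟩

theorem tupRank_mul_le_left (e : β → E) (A : Matrix ν μ (E ⊗[K] R))
    (B : Matrix μ μ' (E ⊗[K] R)) : tupRank rk e (A * B) ≤ tupRank rk e A := by
  let T : (μ → E ⊗[K] R) →ₗ[R] (μ' → E ⊗[K] R) :=
    { toFun := fun x => Matrix.vecMul x B
      map_add' := fun x y => Matrix.add_vecMul _ _ _
      map_smul' := fun r x => Matrix.smul_vecMul _ _ _ }
  refine le_of_eq_of_le ?_ (famRank_map_le hrk T _)
  unfold tupRank
  congr 1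
  ext p j
  simp only [T, LinearMap.coe_mk, AddHom.coe_mk, Matrix.mul_apply, Matrix.vecMul, dotProduct,
    Finset.smul_sum, smul_mul_assoc]

theorem tupRank_mul_le_right {e : β → E} {e' : β' → E} (A : Matrix ν μ (E ⊗[K] R))
    (B : Matrix μ μ' (E ⊗[K] R))
    (h : ∀ b i j, e b • A i j ∈ Submodule.span R (Set.range fun b => e' b ⊗ₜ[K] (1 : R))) :
    tupRank rk e (A * B) ≤ tupRank rk e' B := by
  apply famRank_mono hrk
  rintro ⟨i, b⟩
  have : (fun k => e b • (A * B) i k) = ∑ j, fun k => (e b • A i j) * B j k := by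
    ext k
    rw [Finset.sum_apply, Matrix.mul_apply, Finset.smul_sum]
    simp only [smul_mul_assoc]
  dsimp only
  rw [this]
  refine Submodule.sum_mem _ fun j _ => ?_
  obtain ⟨r, hr⟩ := (Submodule.mem_span_range_iff_exists_fun R).1 (h b i j)
  have : (fun k => (e b • A i j) * B j k) = ∑ b', r b' • fun k => e' b' • B j k := by
    ext k
    rw [← hr, Finset.sum_apply, Finset.sum_mul]
    refine Finset.sum_congr rfl fun b' _ => ?_
    rw [Pi.smul_apply, smul_mul_assoc, tmul_one_mul]
  rw [this]
  exact Submodule.sum_mem _ fun b' _ =>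
    Submodule.smul_mem _ _ (Submodule.subset_span ⟨(j, b'), rfl⟩)

end tupRank

end CoeffModule

end FieldExt

/-! ### Disjoint translates of subspaces of a field -/

section LinearAlgebra

open Module

variable {K : Type*} [Field K]

/-- For a matrix `M` over an infinite field, `1 + s M` is invertible for some `s ≠ 0`. -/
theorem Matrix.exists_det_one_add_smul_ne_zero [Infinite K] {ι : Type*} [Fintype ι]
    [DecidableEq ι] (M : Matrix ι ι K) : ∃ s : K, s ≠ 0 ∧ (1 + s • M).det ≠ 0 := by
  classical
  have hev : ∀ s : K, (Matrix.det (1 + (Polynomial.X : Polynomial K) • M.map Polynomial.C)).eval s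
      = (1 + s • M).det := by
    intro s
    rw [← Polynomial.coe_evalRingHom, RingHom.map_det]
    congr 1
    ext i j
    rcases eq_or_ne i j with rfl | h
    · simpa using mul_comm _ _
    · simpa [h] using mul_comm _ _
  have hp : Polynomial.X * Matrix.det (1 + (Polynomial.X : Polynomial K) • M.map Polynomial.C)
      ≠ 0 := by
    refine mul_ne_zero Polynomial.X_ne_zero fun h => ?_
    have := hev 0
    rw [h] at this
    simp at this
  obtain ⟨s, hs⟩ := Infinite.exists_notMem_finset
    (Polynomial.X *
      Matrix.det (1 + (Polynomial.X : Polynomial K) • M.map Polynomial.C)).roots.toFinset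
  rw [Multiset.mem_toFinset, Polynomial.mem_roots hp, Polynomial.IsRoot.def, Polynomial.eval_mul,
    Polynomial.eval_X, hev, mul_eq_zero, not_or] at hs
  exact ⟨s, hs⟩

variable {P Q : Type*} [AddCommGroup P] [Module K P] [FiniteDimensional K P]
  [AddCommGroup Q] [Module K Q]

/-- If `B` does not map the kernel of `A` into the range of `A`, then some member of the pencil
`A + s B` has larger rank than `A`. -/
theorem LinearMap.exists_finrank_range_lt [Infinite K] (A B : P →ₗ[K] Q) {y : P} (hy : A y = 0)
    (hB : B y ∉ LinearMap.range A) :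
    ∃ s : K, finrank K (LinearMap.range A) < finrank K (LinearMap.range (A + s • B)) := by
  classical
  obtain ⟨r, hr⟩ : ∃ r, finrank K (LinearMap.range A) = r := ⟨_, rfl⟩
  obtain ⟨b⟩ : Nonempty (Basis (Fin r) K (LinearMap.range A)) :=
    ⟨finBasisOfFinrankEq K (LinearMap.range A) hr⟩
  choose f hf using fun i => (b i).2
  let q : Option (Fin r) → Q := fun o => o.elim (B y) fun i => A (f i)
  have hq : LinearIndependent K q := by
    rw [linearIndependent_option]
    have hbi : q ∘ some = fun i => (b i : Q) := funext fun i => hf i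
    constructor
    · rw [hbi]
      exact b.linearIndependent.map' (LinearMap.range A).subtype (Submodule.ker_subtype _)
    · rw [hbi]
      intro h
      refine hB (Submodule.span_le.2 ?_ h)
      rintro _ ⟨i, rfl⟩
      exact (b i).2
  obtain ⟨g, hg⟩ := (Fintype.linearCombination K q).exists_leftInverse_of_injective
    (LinearMap.ker_eq_bot.2 (linearIndependent_iff_injective_fintypeLinearCombination.1 hq))
  have hgq : ∀ o, g (q o) = Pi.single o 1 := fun o => by
    have := LinearMap.congr_fun hg (Pi.single o 1)
    simpa [Fintype.linearCombination_apply_single] using this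
  let M : Matrix (Option (Fin r)) (Option (Fin r)) K :=
    Matrix.of fun o => o.elim 0 fun i => g (B (f i))
  obtain ⟨s, hs0, hs⟩ := M.exists_det_one_add_smul_ne_zero
  refine ⟨s, ?_⟩
  let v : Option (Fin r) → Q := fun o => o.elim (B y) fun i => (A + s • B) (f i)
  have hgv : g ∘ v = (1 + s • M).row := by
    funext o
    rcases o with _ | i
    · have := hgq none
      simp only [q, Option.elim_none] at this
      ext j
      simp only [v, Function.comp_apply, Option.elim_none, this]
      simp [M, Matrix.one_apply, Pi.single_apply, eq_comm]
    · have := hgq (some i)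
      simp only [q, Option.elim_some] at this
      ext j
      simp only [v, Function.comp_apply, Option.elim_some, LinearMap.add_apply,
        LinearMap.smul_apply, map_add, map_smul, this]
      simp [M, Matrix.one_apply, Pi.single_apply, eq_comm]
  have hv : LinearIndependent K v := by
    apply LinearIndependent.of_comp g
    rw [hgv]
    exact Matrix.linearIndependent_rows_of_det_ne_zero hs
  have hvr : Submodule.span K (Set.range v) ≤ LinearMap.range (A + s • B) := by
    rw [Submodule.span_le]
    rintro _ ⟨_ | i, rfl⟩
    · exact ⟨s⁻¹ • y, by simp [v, hy, smul_smul, hs0]⟩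
    · exact ⟨f i, rfl⟩
  have := Submodule.finrank_mono hvr
  rw [finrank_span_eq_card hv, Fintype.card_option, Fintype.card_fin] at this
  rw [hr]
  exact this

end LinearAlgebra

section Translates

open Module

variable {K E : Type*} [Field K] [Field E] [Algebra K E]

theorem finrank_map_mulLeft {x : E} (hx : x ≠ 0) (W : Submodule K E) :
    finrank K (W.map (LinearMap.mulLeft K x)) = finrank K W :=
  (Submodule.equivMapOfInjective _ (mul_right_injective₀ hx) W).finrank_eq.symm

/-- The case of a finite field: otherwise `x ↦ (y, x y)` would inject `W` into a proper subset of
`F × U`. -/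
theorem exists_disjoint_translate_of_finite [Finite K] (U F W : Submodule K E)
    [FiniteDimensional K U] [FiniteDimensional K F] [FiniteDimensional K W] (hF : F ≠ ⊥)
    (h : finrank K U + finrank K F ≤ finrank K W) :
    ∃ x ∈ W, x ≠ 0 ∧ ∀ y ∈ F, x * y ∈ U → y = 0 := by
  classical
  by_contra! hc
  have : Finite U := Module.finite_of_finite K
  have : Finite F := Module.finite_of_finite K
  have : Finite W := Module.finite_of_finite K
  choose! y hyF hyU hy0 using hc
  -- `x ↦ (y, x * y)` is injective on `W` but not surjective, so `|W| < |F| |U|`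
  let φ : W → F × U := fun x =>
    if hx : (x : E) = 0 then 0 else (⟨y x, hyF x x.2 hx⟩, ⟨x * y x, hyU x x.2 hx⟩)
  have hφ : Function.Injective φ := by
    intro a b hab
    by_cases ha : (a : E) = 0 <;> by_cases hb : (b : E) = 0
    · exact Subtype.ext (ha.trans hb.symm)
    · simp only [φ, ha, hb, dif_pos, dif_neg, not_false_eq_true] at hab
      exact absurd (congrArg (fun p => (p.1 : E)) hab).symm (hy0 b b.2 hb)
    · simp only [φ, ha, hb, dif_pos, dif_neg, not_false_eq_true] at hab
      exact absurd (congrArg (fun p => (p.1 : E)) hab) (hy0 a a.2 ha)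
    · simp only [φ, ha, hb, dif_neg, not_false_eq_true] at hab
      have h1 : y a = y b := congrArg (fun p => (p.1 : E)) hab
      have h2 : (a : E) * y a = b * y b := congrArg (fun p => (p.2 : E)) hab
      rw [← h1] at h2
      exact Subtype.ext (mul_right_cancel₀ (hy0 a a.2 ha) h2)
  obtain ⟨z, hzF, hz0⟩ := F.exists_mem_ne_zero_of_ne_bot hF
  have hns : ¬ Function.Surjective φ := by
    intro hs
    obtain ⟨a, ha⟩ := hs (⟨z, hzF⟩, 0)
    by_cases ha0 : (a : E) = 0
    · simp only [φ, ha0, dif_pos] at ha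
      exact hz0 (congrArg (fun p => (p.1 : E)) ha).symm
    · simp only [φ, ha0, dif_neg, not_false_eq_true] at ha
      exact mul_ne_zero ha0 (hy0 a a.2 ha0) (congrArg (fun p => (p.2 : E)) ha)
  have hlt : Nat.card W < Nat.card (F × U) := by
    refine lt_of_le_of_ne (Nat.card_le_card_of_injective φ hφ) fun h => hns ?_
    exact ((Nat.bijective_iff_injective_and_card φ).2 ⟨hφ, h⟩).2
  rw [Nat.card_prod, natCard_eq_pow_finrank (K := K), natCard_eq_pow_finrank (K := K) (V := F),
    natCard_eq_pow_finrank (K := K) (V := U), ← pow_add,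
    Nat.pow_lt_pow_iff_right Finite.one_lt_card] at hlt
  omega

/-- The case of an infinite field: choose `x` such that `F → E / U`, `y ↦ x y`, has the largest
rank. -/
theorem exists_disjoint_translate_of_infinite [Infinite K] (U F W : Submodule K E)
    [FiniteDimensional K U] [FiniteDimensional K F] [FiniteDimensional K W] (hF : F ≠ ⊥)
    (h : finrank K U + finrank K F ≤ finrank K W) :
    ∃ x ∈ W, x ≠ 0 ∧ ∀ y ∈ F, x * y ∈ U → y = 0 := by
  let L : E → F →ₗ[K] E ⧸ U := fun x => U.mkQ ∘ₗ LinearMap.mulLeft K x ∘ₗ F.subtype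
  have hLa : ∀ (x : E) (z : F), L x z = Submodule.Quotient.mk (x * (z : E)) := fun _ _ => rfl
  have hL : ∀ (x y : E) (s : K), L (x + s • y) = L x + s • L y := by
    intro x y s
    ext z
    simp only [L, LinearMap.comp_apply, LinearMap.add_apply, LinearMap.smul_apply,
      LinearMap.mulLeft_apply, add_mul, smul_mul_assoc, map_add, map_smul]
  -- choose `x ∈ W` such that `L x` has the largest possible rank
  obtain ⟨x, hxW, hx⟩ : ∃ x ∈ W, ∀ x' ∈ W,
      finrank K (LinearMap.range (L x')) ≤ finrank K (LinearMap.range (L x)) := by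
    have hne : ((fun x => finrank K F - finrank K (LinearMap.range (L x))) '' W).Nonempty :=
      ⟨_, 0, W.zero_mem, rfl⟩
    obtain ⟨x, hxW, hx⟩ := Nat.sInf_mem hne
    refine ⟨x, hxW, fun x' hx' => ?_⟩
    have h1 := Nat.sInf_le (Set.mem_image_of_mem
      (fun x => finrank K F - finrank K (LinearMap.range (L x))) hx')
    rw [← hx] at h1
    have := (L x').finrank_range_le
    have := (L x).finrank_range_le
    dsimp only at h1
    omega
  have hinj : LinearMap.ker (L x) = ⊥ := by
    by_contra hne
    obtain ⟨y, hyk, hy0⟩ := Submodule.exists_mem_ne_zero_of_ne_bot hne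
    have hy0' : (y : E) ≠ 0 := fun h => hy0 (Subtype.ext h)
    -- otherwise `y W ⊆ U + x F`, which is too small
    have hsub : W.map (LinearMap.mulLeft K (y : E)) ≤ U ⊔ F.map (LinearMap.mulLeft K x) := by
      rintro _ ⟨x', hx', rfl⟩
      by_contra hn
      have hB : L x' y ∉ LinearMap.range (L x) := by
        rintro ⟨z, hz⟩
        apply hn
        have : x' * (y : E) - x * z ∈ U := by
          rw [← Submodule.Quotient.mk_eq_zero, Submodule.Quotient.mk_sub, sub_eq_zero, ← hLa,
            ← hLa, hz]
        rw [LinearMap.mulLeft_apply, mul_comm, ← sub_add_cancel (x' * (y : E)) (x * z)]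
        exact add_mem (Submodule.mem_sup_left this) (Submodule.mem_sup_right ⟨z, z.2, rfl⟩)
      obtain ⟨s, hs⟩ := (L x).exists_finrank_range_lt (L x') hyk hB
      rw [← hL] at hs
      exact absurd (hx _ (W.add_mem hxW (W.smul_mem s hx'))) (not_le.2 hs)
    have h1 := Submodule.finrank_mono hsub
    rw [finrank_map_mulLeft hy0'] at h1
    have h2 := Submodule.finrank_sup_add_finrank_inf_eq U (F.map (LinearMap.mulLeft K x))
    by_cases hx0 : x = 0
    · have : F.map (LinearMap.mulLeft K x) = ⊥ := by
        rw [eq_bot_iff]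
        rintro _ ⟨z, -, rfl⟩
        simp [hx0]
      rw [this, finrank_bot] at h2
      rw [this] at h1
      have : 0 < finrank K F := by
        have : Nontrivial F := Submodule.nontrivial_iff_ne_bot.2 hF
        exact finrank_pos
      omega
    · rw [finrank_map_mulLeft hx0] at h2
      have h3 : (U ⊓ F.map (LinearMap.mulLeft K x)) ≠ ⊥ := by
        rw [Submodule.ne_bot_iff]
        refine ⟨x * y, ⟨?_, ⟨y, y.2, rfl⟩⟩, mul_ne_zero hx0 hy0'⟩
        rw [SetLike.mem_coe, ← Submodule.Quotient.mk_eq_zero, ← hLa]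
        exact hyk
      have : 0 < finrank K ↥(U ⊓ F.map (LinearMap.mulLeft K x)) := by
        have : Nontrivial ↥(U ⊓ F.map (LinearMap.mulLeft K x)) :=
          Submodule.nontrivial_iff_ne_bot.2 h3
        exact finrank_pos
      omega
  have hker : ∀ y ∈ F, x * y ∈ U → y = 0 := by
    intro y hy hU
    have : (⟨y, hy⟩ : F) ∈ LinearMap.ker (L x) := by
      rw [LinearMap.mem_ker, hLa, Submodule.Quotient.mk_eq_zero]
      exact hU
    rw [hinj, Submodule.mem_bot] at this
    exact congrArg Subtype.val this
  refine ⟨x, hxW, ?_, hker⟩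
  rintro rfl
  obtain ⟨z, hzF, hz0⟩ := F.exists_mem_ne_zero_of_ne_bot hF
  exact hz0 (hker z hzF (by simp))

/-- As long as `dim U + dim F ≤ dim W`, some translate `x F` with `x ∈ W` is disjoint from `U`. -/
theorem exists_disjoint_translate (U F W : Submodule K E)
    [FiniteDimensional K U] [FiniteDimensional K F] [FiniteDimensional K W] (hF : F ≠ ⊥)
    (h : finrank K U + finrank K F ≤ finrank K W) :
    ∃ x ∈ W, x ≠ 0 ∧ ∀ y ∈ F, x * y ∈ U → y = 0 := by
  cases finite_or_infinite K
  · exact exists_disjoint_translate_of_finite U F W hF h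
  · exact exists_disjoint_translate_of_infinite U F W hF h

end Translates

/-! ### Invariant subspaces and non-principal ultrafilters -/

namespace FieldExt

open Module

section Existence

variable {K E R : Type*} [Field K] [Field E] [Algebra K E] [Ring R] [Algebra K R]

instance (W : FinSubspace K E) : FiniteDimensional K W.1 := W.2.1

theorem dim_pos (W : FinSubspace K E) : 0 < dim W := by
  have : Nontrivial W.1 := Submodule.nontrivial_iff_ne_bot.2 W.2.2
  exact finrank_pos

theorem dim_pos_real (W : FinSubspace K E) : (0 : ℝ) < dim W := Nat.cast_pos.2 (dim_pos W)

theorem tensorSub_mono {W W' : FinSubspace K E} (h : W.1 ≤ W'.1) :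
    tensorSub R W ≤ tensorSub R W' := by
  refine Submodule.span_mono ?_
  rintro _ ⟨w, hw, r, rfl⟩
  exact ⟨w, h hw, r, rfl⟩

theorem mul_mem_tensorSub {W T W' : FinSubspace K E} (h : W.1 * T.1 ≤ W'.1) {x y : E ⊗[K] R}
    (hx : x ∈ tensorSub R W) (hy : y ∈ tensorSub R T) : x * y ∈ tensorSub R W' := by
  induction hx using Submodule.span_induction with
  | mem x hx =>
    obtain ⟨w, hw, r, rfl⟩ := hx
    induction hy using Submodule.span_induction with
    | mem y hy =>
      obtain ⟨t, ht, s, rfl⟩ := hy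
      exact Submodule.subset_span ⟨w * t, h (Submodule.mul_mem_mul hw ht), r * s, by simp⟩
    | zero => simp
    | add y z _ _ hy hz => rw [mul_add]; exact add_mem hy hz
    | smul c y _ hy => rw [mul_smul_comm]; exact Submodule.smul_mem _ _ hy
  | zero => simp
  | add y z _ _ hy hz => rw [add_mul]; exact add_mem hy hz
  | smul c y _ hy => rw [smul_mul_assoc]; exact Submodule.smul_mem _ _ hy

theorem tmul_one_mem_iff [Nontrivial R] {W : FinSubspace K E} {x : E} :
    x ⊗ₜ[K] (1 : R) ∈ tensorSub R W ↔ x ∈ W.1 := by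
  refine ⟨fun h => ?_, fun h => Submodule.subset_span ⟨x, h, 1, rfl⟩⟩
  obtain ⟨g, hg⟩ := (LinearMap.toSpanSingleton K R 1).exists_leftInverse_of_injective
    (LinearMap.ker_toSpanSingleton K one_ne_zero)
  have hg1 : g 1 = 1 := by simpa using LinearMap.congr_fun hg 1
  let T : E ⊗[K] R →ₗ[K] E := (TensorProduct.rid K E).toLinearMap ∘ₗ g.lTensor E
  have hT : ∀ y ∈ tensorSub R W, T y ∈ W.1 := by
    intro y hy
    induction hy using Submodule.span_induction with
    | mem x h =>
      obtain ⟨w, hw, r, rfl⟩ := h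
      simpa [T] using W.1.smul_mem (g r) hw
    | zero => simp
    | add x y _ _ hx hy => rw [map_add]; exact add_mem hx hy
    | smul c x _ hx => rw [map_smul]; exact Submodule.smul_mem _ _ hx
  simpa [T, hg1] using hT _ h

/-- Powers of a finite-dimensional subspace of a field have polynomially bounded dimension. -/
theorem exists_finrank_pow_le (T : Submodule K E) [FiniteDimensional K T] :
    ∃ d : ℕ, ∀ n, finrank K ↥(T ^ n) ≤ (n + 1) ^ d := by
  classical
  obtain ⟨s, hs⟩ := (Submodule.fg_iff_finiteDimensional T).2 inferInstance
  refine ⟨Fintype.card s, fun n => ?_⟩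
  -- `T ^ n` is spanned by monomials whose exponents are at most `n`
  let b : (s → Fin (n + 1)) → E := fun a => ∏ t : s, (t : E) ^ (a t : ℕ)
  have hle : T ^ n ≤ Submodule.span K (Set.range b) := by
    rw [← hs, Submodule.span_pow]
    refine Submodule.span_mono ?_
    intro x hx
    obtain ⟨f, rfl⟩ := Set.mem_pow.1 hx
    refine ⟨fun t => ⟨Fintype.card {i // f i = t}, Nat.lt_succ_of_le ?_⟩, ?_⟩
    · exact (Fintype.card_subtype_le _).trans_eq (Fintype.card_fin n)
    · rw [List.prod_ofFn, ← Fintype.prod_fiberwise' f (fun t : s => (t : E))]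
      simp [b]
  have := FiniteDimensional.span_of_finite K (Set.finite_range b)
  calc finrank K ↥(T ^ n) ≤ finrank K (Submodule.span K (Set.range b)) :=
        Submodule.finrank_mono hle
    _ ≤ Fintype.card (s → Fin (n + 1)) := finrank_range_le_card b
    _ = _ := by simp

/-- Finitely many elements of `E ⊗ R` lie in a common `T ⊗ R`. -/
theorem exists_mem_tensorSub (V : Finset (E ⊗[K] R)) :
    ∃ T : FinSubspace K E, (1 : E) ∈ T.1 ∧ ∀ v ∈ V, v ∈ tensorSub R T := by
  let W : FinSubspace K E := ⟨Submodule.span K {1}, inferInstance, by simp⟩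
  obtain ⟨p, B, T, w, w', hT, -⟩ := exists_represents (n := 1) W
    (Matrix.of fun _ j => (V.equivFin.symm j : E ⊗[K] R))
  refine ⟨⟨T.1 ⊔ W.1, inferInstance, fun h => W.2.2 (sup_eq_bot_iff.1 h).2⟩,
    Submodule.mem_sup_right (Submodule.mem_span_singleton_self 1), fun v hv => ?_⟩
  have h1 : (1 : E ⊗[K] R) ∈ tensorSub R W :=
    Submodule.subset_span ⟨1, Submodule.mem_span_singleton_self 1, 1, rfl⟩
  have := hT 0 (V.equivFin ⟨v, hv⟩) 1 h1
  simp only [Matrix.of_apply, Equiv.symm_apply_apply, one_mul] at this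
  exact tensorSub_mono (W' := ⟨T.1 ⊔ W.1, _⟩) le_sup_left this

/-- Fields are amenable: `(V, ε)`-invariant subspaces exist. -/
theorem exists_isInvariant (V : Finset (E ⊗[K] R)) {ε : ℝ} (hε : 0 < ε) :
    ∃ W : FinSubspace K E, IsInvariant V ε W := by
  obtain ⟨T, h1, hV⟩ := exists_mem_tensorSub V
  have h1n : ∀ n, (1 : E) ∈ T.1 ^ n := fun n => by
    simpa using Submodule.pow_mem_pow T.1 h1 n
  let P : ℕ → FinSubspace K E := fun n => ⟨T.1 ^ n,
    (Submodule.fg_iff_finiteDimensional _).1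
      (((Submodule.fg_iff_finiteDimensional T.1).2 inferInstance).pow n),
    fun h => one_ne_zero (α := E) (by simpa [h] using h1n n)⟩
  have hP : ∀ n, (P n).1 * T.1 ≤ (P (n + 1)).1 := fun n => (pow_succ T.1 n).ge
  have hP' : ∀ n, (P n).1 ≤ (P (n + 1)).1 := fun n x hx => by
    simpa using hP n (Submodule.mul_mem_mul hx h1)
  -- if no power of `T` is invariant, then the dimensions grow exponentially
  by_contra! hc
  have hgrow : ∀ n, (1 + ε) * dim (P n) < dim (P (n + 1)) := by
    intro n
    by_contra! hn
    exact hc (P n) ⟨P (n + 1), hn, tensorSub_mono (hP' n),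
      fun x hx v hv => mul_mem_tensorSub (hP n) hx (hV v hv)⟩
  have hexp : ∀ n, (1 + ε) ^ n ≤ dim (P n) := by
    intro n
    induction n with
    | zero => simpa using Nat.one_le_iff_ne_zero.2 (dim_pos (P 0)).ne'
    | succ n ih =>
      rw [pow_succ']
      exact (mul_le_mul_of_nonneg_left ih (by positivity)).trans (hgrow n).le
  obtain ⟨d, hd⟩ := exists_finrank_pow_le T.1
  have hlim := (tendsto_pow_const_div_const_pow_of_one_lt d (r := 1 + ε) (by linarith)).comp
    (Filter.tendsto_add_atTop_nat 1)
  have hev := hlim.eventually (gt_mem_nhds (show (0 : ℝ) < 1 / (1 + ε) by positivity))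
  obtain ⟨n, hn⟩ := hev.exists
  have h2 : ((dim (P n) : ℕ) : ℝ) ≤ ((n + 1) ^ d : ℕ) := Nat.cast_le.2 (hd n)
  have h3 := (hexp n).trans h2
  simp only [Function.comp_apply] at hn
  rw [div_lt_div_iff₀ (by positivity) (by positivity), one_mul, pow_succ] at hn
  push_cast at h3 hn
  have := mul_le_mul_of_nonneg_right h3 (show 0 ≤ 1 + ε by positivity)
  linarith

theorem IsInvariant.mono {V V' : Finset (E ⊗[K] R)} (hV : V ⊆ V') {ε ε' : ℝ} (hε : ε' ≤ ε)
    {W : FinSubspace K E} (h : IsInvariant V' ε' W) : IsInvariant V ε W := by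
  obtain ⟨W', h1, h2, h3⟩ := h
  refine ⟨W', h1.trans ?_, h2, fun x hx v hv => h3 x hx v (hV hv)⟩
  gcongr

variable (K E R) in
theorem exists_nonPrincipal : ∃ ω : Ultrafilter (FinSubspace K E), NonPrincipal R ω := by
  classical
  let g : Finset (E ⊗[K] R) × {ε : ℝ // 0 < ε} → Filter (FinSubspace K E) :=
    fun p => Filter.principal {W | IsInvariant p.1 p.2 W}
  have : Nonempty (Finset (E ⊗[K] R) × {ε : ℝ // 0 < ε}) := ⟨(∅, ⟨1, one_pos⟩)⟩
  have hne : (iInf g).NeBot := by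
    apply Filter.iInf_neBot_of_directed'
    · intro p q
      refine ⟨(p.1 ∪ q.1, ⟨min p.2 q.2, lt_min p.2.2 q.2.2⟩), ?_, ?_⟩
      · exact Filter.principal_mono.2 fun W h =>
          h.mono Finset.subset_union_left (min_le_left _ _)
      · exact Filter.principal_mono.2 fun W h =>
          h.mono Finset.subset_union_right (min_le_right _ _)
    · intro p
      exact Filter.principal_neBot_iff.2 (exists_isInvariant p.1 p.2.2)
  refine ⟨Ultrafilter.of (iInf g), fun V ε hε => ?_⟩
  exact (Ultrafilter.of_le (iInf g)).trans (iInf_le g (V, ⟨ε, hε⟩))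
    (Filter.mem_principal_self _)

/-- Invariance, applied to the elements `y ⊗ 1` with `y ∈ F`, in terms of subspaces of `E`. -/
theorem NonPrincipal.eventually [Nontrivial R] {ω : Ultrafilter (FinSubspace K E)}
    (hω : NonPrincipal R ω) (F : Submodule K E) [FiniteDimensional K F] {ε : ℝ} (hε : 0 < ε) :
    ∀ᶠ W in (ω : Filter (FinSubspace K E)), ∃ W' : FinSubspace K E, W.1 ≤ W'.1 ∧
      (∀ x ∈ W.1, ∀ y ∈ F, x * y ∈ W'.1) ∧ (dim W' : ℝ) ≤ (1 + ε) * dim W := by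
  classical
  obtain ⟨s, hs⟩ := (Submodule.fg_iff_finiteDimensional F).2 inferInstance
  filter_upwards [hω (s.image fun y => y ⊗ₜ[K] (1 : R)) ε hε]
  rintro W ⟨W', h1, h2, h3⟩
  refine ⟨W', fun x hx => tmul_one_mem_iff.1 (h2 (tmul_one_mem_iff.2 hx)), fun x hx y hy => ?_, h1⟩
  rw [← hs] at hy
  induction hy using Submodule.span_induction with
  | mem y hy =>
    have := h3 _ (tmul_one_mem_iff.2 hx) _ (Finset.mem_image_of_mem _ hy)
    rw [Algebra.TensorProduct.tmul_mul_tmul, one_mul] at this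
    exact tmul_one_mem_iff.1 this
  | zero => simp
  | add y z _ _ hy hz => rw [mul_add]; exact add_mem hy hz
  | smul c y _ hy => rw [mul_smul_comm]; exact Submodule.smul_mem _ _ hy

end Existence

/-! ### Limits of subadditive functions along non-principal ultrafilters -/

section Subadditive

variable {K E : Type*} [Field K] [Field E] [Algebra K E]

/-- A function on the finite-dimensional subspaces of the field `E` that is nonnegative, monotone,
subadditive, invariant under multiplication by nonzero elements of `E`, and bounded by a multiple
of the dimension. Values at infinite-dimensional subspaces are irrelevant. -/
structure IsInvariantSubadditive (f : Submodule K E → ℝ) (c : ℝ) : Prop where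
  nonneg : ∀ U, 0 ≤ f U
  mono : ∀ U V : Submodule K E, FiniteDimensional K U → FiniteDimensional K V → U ≤ V → f U ≤ f V
  sup_le_add : ∀ U V : Submodule K E, FiniteDimensional K U → FiniteDimensional K V →
    f (U ⊔ V) ≤ f U + f V
  translate_le : ∀ U : Submodule K E, FiniteDimensional K U → ∀ x : E,
    f (U.map (LinearMap.mulLeft K x)) ≤ f U
  le_finrank : ∀ U : Submodule K E, FiniteDimensional K U → f U ≤ c * finrank K U

/-- A complement of `U` inside `W`. -/
theorem exists_sup_eq {U W : Submodule K E} [FiniteDimensional K W] (h : U ≤ W) :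
    ∃ D ≤ W, U ⊔ D = W ∧ finrank K U + finrank K D = finrank K W := by
  obtain ⟨C, hC⟩ := U.exists_isCompl
  have : FiniteDimensional K U := Submodule.finiteDimensional_of_le h
  have hs : U ⊔ C ⊓ W = W := by
    rw [← sup_inf_assoc_of_le C h, hC.sup_eq_top, top_inf_eq]
  refine ⟨C ⊓ W, inf_le_right, hs, ?_⟩
  have := Submodule.finrank_sup_add_finrank_inf_eq U (C ⊓ W)
  rw [hs, ← inf_assoc, hC.inf_eq_bot, bot_inf_eq, finrank_bot] at this
  omega

variable {f : Submodule K E → ℝ} {c : ℝ} (hf : IsInvariantSubadditive f c)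
include hf

/-- Inside any subspace containing `W F`, one can find a direct sum of `k` translates of `F`, as
long as `k dim F ≤ dim W`. -/
theorem IsInvariantSubadditive.exists_tiling {F W W' : Submodule K E} [FiniteDimensional K F]
    [FiniteDimensional K W] [FiniteDimensional K W'] (hF : F ≠ ⊥)
    (h : ∀ x ∈ W, ∀ y ∈ F, x * y ∈ W') (k : ℕ) (hk : k * finrank K F ≤ finrank K W) :
    ∃ U ≤ W', finrank K U = k * finrank K F ∧ f U ≤ k * f F := by
  induction k with
  | zero =>
    refine ⟨⊥, bot_le, by simp, ?_⟩
    simpa using hf.le_finrank ⊥ inferInstance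
  | succ k ih =>
    rw [add_one_mul] at hk
    obtain ⟨U, hU, hd, hfU⟩ := ih (by omega)
    have : FiniteDimensional K U := Submodule.finiteDimensional_of_le hU
    obtain ⟨x, hxW, hx0, hx⟩ := exists_disjoint_translate U F W hF (by omega)
    refine ⟨U ⊔ F.map (LinearMap.mulLeft K x), sup_le hU ?_, ?_, ?_⟩
    · rintro _ ⟨y, hy, rfl⟩
      exact h x hxW y hy
    · have hinf : U ⊓ F.map (LinearMap.mulLeft K x) = ⊥ := by
        rw [eq_bot_iff]
        rintro _ ⟨hyU, ⟨y, hy, rfl⟩⟩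
        rw [hx y hy hyU]
        simp
      have := Submodule.finrank_sup_add_finrank_inf_eq U (F.map (LinearMap.mulLeft K x))
      rw [hinf, finrank_bot, finrank_map_mulLeft hx0] at this
      rw [add_one_mul]
      omega
    · push_cast
      rw [add_one_mul]
      exact (hf.sup_le_add _ _ inferInstance inferInstance).trans
        (add_le_add hfU (hf.translate_le F inferInstance x))

/-- The upper bound for `f W` from a tiling of an almost invariant `W` by translates of `F`. The
dimension of the untiled part of `W'` is less than `dim W' - dim W + dim F`. -/
theorem IsInvariantSubadditive.le_of_invariant (hc : 0 ≤ c) {F W W' : Submodule K E}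
    [FiniteDimensional K F]
    [FiniteDimensional K W] [FiniteDimensional K W'] (hF : F ≠ ⊥) (hW : W ≤ W')
    (h : ∀ x ∈ W, ∀ y ∈ F, x * y ∈ W') :
    f W ≤ finrank K W * (f F / finrank K F) +
      c * (finrank K W' - finrank K W + finrank K F) := by
  have hFpos : 0 < finrank K F := by
    have : Nontrivial F := Submodule.nontrivial_iff_ne_bot.2 hF
    exact finrank_pos
  set k := finrank K W / finrank K F
  have hk : k * finrank K F ≤ finrank K W := Nat.div_mul_le_self _ _
  have hk' : finrank K W < (k + 1) * finrank K F := by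
    rw [mul_comm]
    exact Nat.lt_mul_div_succ _ hFpos
  obtain ⟨U, hU, hd, hfU⟩ := hf.exists_tiling hF h k hk
  have : FiniteDimensional K U := Submodule.finiteDimensional_of_le hU
  obtain ⟨D, hD, hs, hDd⟩ := exists_sup_eq hU
  have : FiniteDimensional K D := Submodule.finiteDimensional_of_le hD
  have h1 : f W ≤ f U + f D := by
    refine (hf.mono W W' inferInstance inferInstance hW).trans ?_
    rw [← hs]
    exact hf.sup_le_add _ _ inferInstance inferInstance
  have h2 : (k : ℝ) * f F ≤ finrank K W * (f F / finrank K F) := by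
    rw [mul_div_assoc', le_div_iff₀ (by positivity)]
    have : (k : ℝ) * finrank K F ≤ finrank K W := by exact_mod_cast hk
    nlinarith [hf.nonneg F]
  have h3 : (finrank K D : ℝ) ≤ finrank K W' - finrank K W + finrank K F := by
    have e1 : (finrank K U : ℝ) + finrank K D = finrank K W' := by exact_mod_cast hDd
    have e2 : (finrank K W : ℝ) < finrank K U + finrank K F := by
      rw [add_one_mul, ← hd] at hk'
      exact_mod_cast hk'
    linarith
  have h4 := (hf.le_finrank D inferInstance).trans (mul_le_mul_of_nonneg_left h3 hc)
  linarith

variable {R : Type*} [Ring R] [Algebra K R] [Nontrivial R]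

/-- Over an extension of infinite degree, the limit of `f W / dim W` is a lower bound of all values
of this quotient. -/
theorem IsInvariantSubadditive.limit_le (hc : 0 ≤ c) (hE : ¬ FiniteDimensional K E)
    {ω : Ultrafilter (FinSubspace K E)} (hω : NonPrincipal R ω) {L : ℝ}
    (hL : Filter.Tendsto (fun W : FinSubspace K E => f W.1 / (dim W : ℝ)) ω (nhds L))
    (F : FinSubspace K E) : L ≤ f F.1 / dim F := by
  classical
  refine le_of_forall_pos_le_add fun δ hδ => ?_
  obtain ⟨η, hη, hη2⟩ : ∃ η : ℝ, 0 < η ∧ c * (η + η) ≤ δ := by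
    refine ⟨δ / (2 * (c + 1)), by positivity, ?_⟩
    field_simp
    nlinarith
  -- members of `ω` have large dimension
  have hbig : ∀ᶠ W in (ω : Filter (FinSubspace K E)), (dim F : ℝ) ≤ η * dim W := by
    obtain ⟨N, hN⟩ := exists_nat_ge (2 * dim F / η)
    have hinf : Infinite (Basis.ofVectorSpaceIndex K E) := by
      by_contra h
      rw [not_infinite_iff_finite] at h
      exact hE (Module.Finite.of_basis (Basis.ofVectorSpace K E))
    obtain ⟨s, hs⟩ := Infinite.exists_subset_card_eq (Basis.ofVectorSpaceIndex K E) N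
    have hli : LinearIndependent K fun i : s => Basis.ofVectorSpace K E i :=
      (Basis.ofVectorSpace K E).linearIndependent.comp _ Subtype.val_injective
    set G := Submodule.span K (Set.range fun i : s => Basis.ofVectorSpace K E i)
    have hG : finrank K G = N := by
      rw [finrank_span_eq_card hli, Fintype.card_coe, hs]
    have hGfd : FiniteDimensional K G := FiniteDimensional.span_of_finite K (Set.finite_range _)
    filter_upwards [hω.eventually G one_pos]
    rintro W ⟨W', -, h2, h3⟩
    obtain ⟨x, hx, hx0⟩ := Submodule.exists_mem_ne_zero_of_ne_bot W.2.2
    have hle : G.map (LinearMap.mulLeft K x) ≤ W'.1 := by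
      rintro _ ⟨y, hy, rfl⟩
      exact h2 x hx y hy
    have := Submodule.finrank_mono hle
    rw [finrank_map_mulLeft hx0, hG] at this
    have h4 : (N : ℝ) ≤ dim W' := by exact_mod_cast this
    rw [div_le_iff₀ hη] at hN
    nlinarith
  refine le_of_tendsto hL ?_
  filter_upwards [hbig, hω.eventually F.1 hη]
  rintro W hW ⟨W', h1, h2, h3⟩
  have hpos := dim_pos_real W
  rw [div_le_iff₀ hpos]
  refine (hf.le_of_invariant hc F.2.2 h1 h2).trans ?_
  have h4 : ((finrank K W'.1 : ℝ) - finrank K W.1 + finrank K F.1) ≤ (η + η) * dim W := by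
    change (dim W' : ℝ) - dim W + dim F ≤ _
    linarith
  have h5 := mul_le_mul_of_nonneg_left h4 hc
  have h6 := mul_le_mul_of_nonneg_right hη2 hpos.le
  change (dim W : ℝ) * (f F.1 / dim F) + _ ≤ _
  nlinarith

omit hf in
/-- Over an extension of finite degree, the only non-principal ultrafilter is concentrated
at `E`. -/
theorem NonPrincipal.eventually_eq_top [FiniteDimensional K E]
    {ω : Ultrafilter (FinSubspace K E)} (hω : NonPrincipal R ω) :
    ∀ᶠ W in (ω : Filter (FinSubspace K E)), W.1 = ⊤ := by
  have hpos : (0 : ℝ) < finrank K E := Nat.cast_pos.2 finrank_pos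
  filter_upwards [hω.eventually (⊤ : Submodule K E)
    (show (0 : ℝ) < 1 / (2 * finrank K E) by positivity)]
  rintro W ⟨W', -, h2, h3⟩
  obtain ⟨x, hx, hx0⟩ := Submodule.exists_mem_ne_zero_of_ne_bot W.2.2
  have hW' : W'.1 = ⊤ := by
    rw [eq_top_iff]
    intro y _
    have := h2 x hx (x⁻¹ * y) trivial
    rwa [mul_inv_cancel_left₀ hx0] at this
  have hdW' : dim W' = finrank K E := by rw [dim, hW', finrank_top]
  have hle : dim W ≤ finrank K E := Submodule.finrank_le _
  have hle' : (dim W : ℝ) ≤ finrank K E := by exact_mod_cast hle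
  apply Submodule.eq_top_of_finrank_eq
  change dim W = _
  refine le_antisymm hle ?_
  rw [hdW', add_mul, one_mul] at h3
  have h4 : 1 / (2 * (finrank K E : ℝ)) * dim W < 1 := by
    rw [div_mul_eq_mul_div, div_lt_one (by positivity)]
    linarith
  have h5 : (finrank K E : ℝ) < (dim W + 1 : ℕ) := by push_cast; linarith
  exact Nat.lt_succ_iff.1 (by exact_mod_cast h5)

/-- The limit of `f W / dim W` is the same along all non-principal ultrafilters. -/
theorem IsInvariantSubadditive.limit_unique (hc : 0 ≤ c)
    {ω ω' : Ultrafilter (FinSubspace K E)} (hω : NonPrincipal R ω) (hω' : NonPrincipal R ω')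
    {L L' : ℝ}
    (hL : Filter.Tendsto (fun W : FinSubspace K E => f W.1 / (dim W : ℝ)) ω (nhds L))
    (hL' : Filter.Tendsto (fun W : FinSubspace K E => f W.1 / (dim W : ℝ)) ω' (nhds L')) :
    L = L' := by
  by_cases hE : FiniteDimensional K E
  · have key : ∀ {ω : Ultrafilter (FinSubspace K E)} {L : ℝ}, NonPrincipal R ω →
        Filter.Tendsto (fun W : FinSubspace K E => f W.1 / (dim W : ℝ)) ω (nhds L) →
        L = f ⊤ / finrank K E := by
      intro ω L hω hL
      refine tendsto_nhds_unique hL (tendsto_const_nhds.congr' ?_)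
      filter_upwards [hω.eventually_eq_top] with W hW
      rw [dim, hW, finrank_top]
    rw [key hω hL, key hω' hL']
  · apply le_antisymm
    · exact ge_of_tendsto' hL' fun F => hf.limit_le hc hE hω hL F
    · exact ge_of_tendsto' hL fun F => hf.limit_le hc hE hω' hL' F

end Subadditive

end FieldExt

/-! ### Extended rank functions -/

namespace FieldExt

open Module

attribute [local instance] coeffModule

section Blocks

variable {K E R : Type*} [Field K] [Field E] [Algebra K E] [Ring R] [Algebra K R]
  {rk : MatrixFunction R} (hrk : IsSylvesterMatrixRank rk)
  {β ν ν' μ μ' : Type*} [Fintype β] [Fintype ν] [Fintype ν'] [Fintype μ] [Fintype μ']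
include hrk

theorem tupRank_submatrix_le (e : β → E) (A : Matrix ν μ (E ⊗[K] R)) (f : ν' → ν) (g : μ' → μ) :
    tupRank rk e (A.submatrix f g) ≤ tupRank rk e A := by
  refine le_trans (famRank_mono hrk ?_) (famRank_map_le hrk (LinearMap.funLeft R (E ⊗[K] R) g)
    fun (p : ν × β) (j : μ) => e p.2 • A p.1 j)
  rintro ⟨i, b⟩
  exact Submodule.subset_span ⟨(f i, b), rfl⟩

theorem tupRank_reindex (e : β → E) (A : Matrix ν μ (E ⊗[K] R)) (f : ν ≃ ν') (g : μ ≃ μ') :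
    tupRank rk e (Matrix.reindex f g A) = tupRank rk e A := by
  apply le_antisymm
  · exact tupRank_submatrix_le hrk e A _ _
  · have := tupRank_submatrix_le hrk e (Matrix.reindex f g A) f g
    simpa using this

theorem tupRank_fromBlocks_triangular (e : β → E) (A : Matrix ν μ (E ⊗[K] R))
    (B : Matrix ν' μ' (E ⊗[K] R)) (C : Matrix ν μ' (E ⊗[K] R)) :
    tupRank rk e A + tupRank rk e B ≤ tupRank rk e (Matrix.fromBlocks A C 0 B) := by
  refine (famRank_triangular hrk (fun (p : ν × β) (j : μ) => e p.2 • A p.1 j)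
    (fun (p : ν × β) (j : μ') => e p.2 • C p.1 j)
    (fun (p : ν' × β) (j : μ') => e p.2 • B p.1 j)).trans ?_
  refine le_trans (famRank_mono hrk (fun k => ?_)) (famRank_map_le hrk
    (LinearEquiv.sumArrowLequivProdArrow μ μ' R (E ⊗[K] R)).toLinearMap _)
  rcases k with ⟨i, b⟩ | ⟨i, b⟩
  · exact Submodule.subset_span ⟨(Sum.inl i, b), rfl⟩
  · refine Submodule.subset_span ⟨(Sum.inr i, b), ?_⟩
    refine Prod.ext (funext fun j => ?_) rfl
    exact smul_zero (e b)

theorem tupRank_fromBlocks_diag_le (e : β → E) (A : Matrix ν μ (E ⊗[K] R))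
    (B : Matrix ν' μ' (E ⊗[K] R)) :
    tupRank rk e (Matrix.fromBlocks A 0 0 B) ≤ tupRank rk e A + tupRank rk e B := by
  let φ := (LinearEquiv.sumArrowLequivProdArrow μ μ' R (E ⊗[K] R)).symm.toLinearMap
  refine le_trans ?_ (add_le_add
    (famRank_map_le hrk (φ ∘ₗ LinearMap.inl R _ _) fun (p : ν × β) (j : μ) => e p.2 • A p.1 j)
    (famRank_map_le hrk (φ ∘ₗ LinearMap.inr R _ _) fun (p : ν' × β) (j : μ') => e p.2 • B p.1 j))
  refine le_trans (famRank_mono hrk ?_) (famRank_sumElim_le hrk _ _)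
  rintro ⟨i | i, b⟩
  · refine Submodule.subset_span ⟨Sum.inl (i, b), ?_⟩
    ext (j | j)
    · rfl
    · exact (smul_zero (e b)).symm
  · refine Submodule.subset_span ⟨Sum.inr (i, b), ?_⟩
    ext (j | j)
    · exact (smul_zero (e b)).symm
    · rfl

/-- The rank of the identity on the span of `e` is the dimension of this span. -/
theorem tupRank_one {e : β → E} (he : LinearIndependent K e) :
    tupRank rk e (1 : Matrix (Fin 1) (Fin 1) (E ⊗[K] R)) = Fintype.card β := by
  classical
  obtain ⟨φ, hφ⟩ := exists_isCoord_tmul (R := R) he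
  have h1 : famRank rk (fun b => e b ⊗ₜ[K] (1 : R)) = Fintype.card β := by
    rw [famRank_eq hrk hφ (1 : Matrix β β R) (by simp [Matrix.one_apply]), rankF_one hrk]
  rw [← h1, ← famRank_map_eq hrk
    (LinearEquiv.funUnique (Fin 1) R (E ⊗[K] R)).symm.toLinearMap
    (LinearEquiv.funUnique (Fin 1) R (E ⊗[K] R)).toLinearMap (fun x => rfl)]
  have h2 : ∀ b, (fun j => e b • (1 : Matrix (Fin 1) (Fin 1) (E ⊗[K] R)) 0 j) =
      (LinearEquiv.funUnique (Fin 1) R (E ⊗[K] R)).symm.toLinearMap (e b ⊗ₜ[K] (1 : R)) := by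
    intro b
    ext j
    rw [Subsingleton.elim j 0, Matrix.one_apply_eq, ← tmul_one_mul, mul_one]
    rfl
  apply le_antisymm
  · apply famRank_mono hrk
    rintro ⟨i, b⟩
    rw [Subsingleton.elim i 0]
    exact Submodule.subset_span ⟨b, (h2 b).symm⟩
  · apply famRank_mono hrk
    intro b
    exact Submodule.subset_span ⟨(0, b), h2 b⟩

end Blocks

section SubspaceRank

variable {K E R : Type*} [Field K] [Field E] [Algebra K E] [Ring R] [Algebra K R]

open Classical in
/-- The function `W ↦ rk_W(A)`, extended to the zero subspace; it is set to `0` at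
infinite-dimensional subspaces. -/
noncomputable def subspaceRank (rk : MatrixFunction R) {ν μ : Type*} [Fintype ν] [Fintype μ]
    (A : Matrix ν μ (E ⊗[K] R)) (U : Submodule K E) : ℝ :=
  if _h : FiniteDimensional K U then tupRank rk (fun i => (finBasis K U i : E)) A else 0

theorem span_range_finBasis (U : Submodule K E) [FiniteDimensional K U] :
    Submodule.span K (Set.range fun i => (finBasis K U i : E)) = U := by
  have := congrArg (Submodule.map U.subtype) (finBasis K U).span_eq
  rw [Submodule.map_span, ← Set.range_comp, Submodule.map_top, Submodule.range_subtype] at this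
  exact this

theorem linearIndependent_finBasis (U : Submodule K E) [FiniteDimensional K U] :
    LinearIndependent K fun i => (finBasis K U i : E) :=
  (finBasis K U).linearIndependent.map' U.subtype (Submodule.ker_subtype U)

variable {rk : MatrixFunction R} (hrk : IsSylvesterMatrixRank rk)
include hrk

theorem subspaceRank_eq {β ν μ : Type*} [Fintype β] [Fintype ν] [Fintype μ] {e : β → E}
    {U : Submodule K E} (he : Submodule.span K (Set.range e) = U)
    (A : Matrix ν μ (E ⊗[K] R)) : subspaceRank rk A U = tupRank rk e A := by
  have : FiniteDimensional K U := he ▸ FiniteDimensional.span_of_finite K (Set.finite_range e)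
  rw [subspaceRank, dif_pos this]
  apply le_antisymm
  · refine tupRank_mono hrk (fun b => ?_) A
    rw [he]
    exact (finBasis K U b).2
  · refine tupRank_mono hrk (fun b => ?_) A
    rw [span_range_finBasis, ← he]
    exact Submodule.subset_span ⟨b, rfl⟩

theorem rankOn_eq_subspaceRank (W : FinSubspace K E) {n m : ℕ}
    (A : Matrix (Fin n) (Fin m) (E ⊗[K] R)) : rankOn rk W A = subspaceRank rk A W.1 := by
  rw [rankOn_eq_tupRank hrk (span_range_finBasis W.1),
    subspaceRank_eq hrk (span_range_finBasis W.1)]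

theorem isInvariantSubadditive_subspaceRank {ν μ : Type*} [Fintype ν] [Fintype μ]
    (A : Matrix ν μ (E ⊗[K] R)) :
    IsInvariantSubadditive (subspaceRank rk A) (Fintype.card ν) where
  nonneg U := by
    unfold subspaceRank
    split_ifs
    · exact tupRank_nonneg hrk _ _
    · exact le_rfl
  mono U V _ _ h := by
    rw [subspaceRank_eq hrk (span_range_finBasis U), subspaceRank_eq hrk (span_range_finBasis V)]
    refine tupRank_mono hrk (fun b => ?_) A
    rw [span_range_finBasis]
    exact h (finBasis K U b).2
  sup_le_add U V _ _ := by
    rw [subspaceRank_eq hrk (span_range_finBasis U), subspaceRank_eq hrk (span_range_finBasis V),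
      subspaceRank_eq hrk (e := Sum.elim (fun i => (finBasis K U i : E))
        fun i => (finBasis K V i : E))]
    · exact tupRank_sumElim_le hrk _ _ _
    · rw [Set.Sum.elim_range, Submodule.span_union, span_range_finBasis, span_range_finBasis]
  translate_le U _ x := by
    rw [subspaceRank_eq hrk (span_range_finBasis U),
      subspaceRank_eq hrk (e := fun i => x * (finBasis K U i : E))]
    · exact tupRank_smul_le hrk _ _ _
    · conv_rhs => rw [← span_range_finBasis U]
      rw [Submodule.map_span, ← Set.range_comp]
      rfl
  le_finrank U _ := by
    rw [subspaceRank_eq hrk (span_range_finBasis U)]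
    simpa using tupRank_le hrk (fun i => (finBasis K U i : E)) A

end SubspaceRank

section RankExt

variable {K E R : Type*} [Field K] [Field E] [Algebra K E] [Ring R] [Algebra K R]
  {rk : MatrixFunction R} (hrk : IsSylvesterMatrixRank rk)
include hrk

theorem tendsto_subspaceRank (ω : Ultrafilter (FinSubspace K E)) {n m : ℕ}
    (A : Matrix (Fin n) (Fin m) (E ⊗[K] R)) :
    Filter.Tendsto (fun W : FinSubspace K E => subspaceRank rk A W.1 / (dim W : ℝ)) ω
      (nhds (rankExt rk ω n m A)) := by
  simpa only [rankOn_eq_subspaceRank hrk] using tendsto_rankExt hrk ω A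

/-- The extended rank function does not depend on the non-principal ultrafilter. -/
theorem rankExt_eq_of_nonPrincipal {ω ω' : Ultrafilter (FinSubspace K E)} (hω : NonPrincipal R ω)
    (hω' : NonPrincipal R ω') : rankExt rk ω = rankExt rk ω' := by
  have := hrk.nontrivial
  funext n m A
  exact (isInvariantSubadditive_subspaceRank hrk A).limit_unique (Nat.cast_nonneg _) hω hω'
    (tendsto_subspaceRank hrk ω A) (tendsto_subspaceRank hrk ω' A)

/-- On each `W`, the product satisfies `rk_W(A B) ≤ rk_W'(B)` with `W' ⊇ W A`, and almost invariance
bounds the difference between `rk_W'(B)` and `rk_W(B)`. -/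
theorem rankExt_mul_le_right {ω : Ultrafilter (FinSubspace K E)} (hω : NonPrincipal R ω)
    {n m l : ℕ} (A : Matrix (Fin n) (Fin m) (E ⊗[K] R)) (B : Matrix (Fin m) (Fin l) (E ⊗[K] R)) :
    rankExt rk ω n l (A * B) ≤ rankExt rk ω m l B := by
  classical
  have hf := isInvariantSubadditive_subspaceRank hrk B
  refine le_of_forall_pos_le_add fun δ hδ => ?_
  obtain ⟨ε, hε, hε2⟩ : ∃ ε : ℝ, 0 < ε ∧ m * ε ≤ δ := by
    refine ⟨δ / (m + 1), by positivity, ?_⟩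
    rw [mul_div_assoc', div_le_iff₀ (by positivity)]
    nlinarith
  let V : Finset (E ⊗[K] R) := Finset.univ.image fun p : Fin n × Fin m => A p.1 p.2
  refine le_of_tendsto_of_tendsto (tendsto_subspaceRank hrk ω (A * B))
    ((tendsto_subspaceRank hrk ω B).add_const δ) ?_
  filter_upwards [hω V ε hε]
  rintro W ⟨W', h1, h2, h3⟩
  have := hrk.nontrivial
  have hWW' : W.1 ≤ W'.1 := fun x hx => tmul_one_mem_iff.1 (h2 (tmul_one_mem_iff.2 hx))
  have hAB : subspaceRank rk (A * B) W.1 ≤ subspaceRank rk B W'.1 := by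
    rw [subspaceRank_eq hrk (span_range_finBasis W.1),
      subspaceRank_eq hrk (span_range_finBasis W'.1)]
    refine tupRank_mul_le_right hrk A B fun b i j => ?_
    apply mem_span_of_mem_tensorSub (W := W') (span_range_finBasis W'.1).ge
    rw [← tmul_one_mul]
    exact h3 _ (tmul_one_mem_iff.2 (finBasis K W.1 b).2) _
      (Finset.mem_image_of_mem _ (Finset.mem_univ (i, j)))
  obtain ⟨D, hD, hs, hDd⟩ := exists_sup_eq hWW'
  have : FiniteDimensional K D := Submodule.finiteDimensional_of_le hD
  have h4 : subspaceRank rk B W'.1 ≤ subspaceRank rk B W.1 + m * finrank K D := by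
    have := hf.le_finrank D inferInstance
    rw [Fintype.card_fin] at this
    rw [← hs]
    exact (hf.sup_le_add _ _ inferInstance inferInstance).trans (add_le_add le_rfl this)
  have h5 : (finrank K D : ℝ) ≤ ε * dim W := by
    have : (dim W : ℝ) + finrank K D = dim W' := by exact_mod_cast hDd
    linarith
  have hpos := dim_pos_real W
  rw [div_add' _ _ _ hpos.ne', div_le_div_iff_of_pos_right hpos]
  have h6 : (m : ℝ) * finrank K D ≤ m * (ε * dim W) := by gcongr
  have h7 := mul_le_mul_of_nonneg_right hε2 hpos.le
  linarith

theorem isSylvesterMatrixRank_rankExt {ω : Ultrafilter (FinSubspace K E)}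
    (hω : NonPrincipal R ω) : IsSylvesterMatrixRank (rankExt rk ω) where
  nonneg A := ge_of_tendsto' (tendsto_subspaceRank hrk ω A) fun W =>
    div_nonneg ((isInvariantSubadditive_subspaceRank hrk A).nonneg _) (Nat.cast_nonneg _)
  map_zero n m := by
    refine tendsto_nhds_unique (tendsto_subspaceRank hrk ω _) (tendsto_const_nhds.congr fun W => ?_)
    rw [subspaceRank_eq hrk (span_range_finBasis W.1), tupRank]
    have : (fun (p : Fin n × Fin (finrank K W.1)) (j : Fin m) => (finBasis K W.1 p.2 : E) •
        (0 : Matrix (Fin n) (Fin m) (E ⊗[K] R)) p.1 j) = 0 := by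
      ext p j
      exact smul_zero _
    rw [this, famRank_zero hrk, zero_div]
  map_one := by
    refine tendsto_nhds_unique (tendsto_subspaceRank hrk ω _) (tendsto_const_nhds.congr fun W => ?_)
    rw [subspaceRank_eq hrk (span_range_finBasis W.1), tupRank_one hrk
      (linearIndependent_finBasis W.1), Fintype.card_fin]
    exact (div_self (dim_pos_real W).ne').symm
  mul_le A B := by
    refine le_min ?_ (rankExt_mul_le_right hrk hω A B)
    refine le_of_tendsto_of_tendsto' (tendsto_subspaceRank hrk ω _) (tendsto_subspaceRank hrk ω _)
      fun W => ?_
    rw [subspaceRank_eq hrk (span_range_finBasis W.1),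
      subspaceRank_eq hrk (span_range_finBasis W.1)]
    gcongr
    exact tupRank_mul_le_left hrk _ _ _
  diag A B := by
    refine tendsto_nhds_unique (tendsto_subspaceRank hrk ω _)
      (((tendsto_subspaceRank hrk ω A).add (tendsto_subspaceRank hrk ω B)).congr fun W => ?_)
    simp only [subspaceRank_eq hrk (span_range_finBasis W.1), tupRank_reindex hrk]
    rw [← add_div]
    congr 1
    exact le_antisymm (tupRank_fromBlocks_triangular hrk _ _ _ _)
      (tupRank_fromBlocks_diag_le hrk _ _ _)
  triangular A B C := by
    refine le_of_tendsto_of_tendsto'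
      ((tendsto_subspaceRank hrk ω A).add (tendsto_subspaceRank hrk ω B))
      (tendsto_subspaceRank hrk ω _) fun W => ?_
    simp only [subspaceRank_eq hrk (span_range_finBasis W.1), tupRank_reindex hrk]
    rw [← add_div]
    gcongr
    exact tupRank_fromBlocks_triangular hrk _ _ _ _

end RankExt

end FieldExt

/-! ### Iterated extensions -/

namespace FieldExt

open Module

attribute [local instance] coeffModule

section Iterated

variable {K E E' R : Type*} [Field K] [Field E] [Field E'] [Algebra K E] [Algebra E E']
  [Algebra K E'] [IsScalarTower K E E'] [Ring R] [Algebra K R]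

variable (K E E' R) in
/-- The canonical identification `E' ⊗ (E ⊗ R) ≃ E' ⊗ R`. -/
noncomputable abbrev cancel : E' ⊗[E] (E ⊗[K] R) ≃ₗ[E'] E' ⊗[K] R :=
  TensorProduct.AlgebraTensorModule.cancelBaseChange K E E' E' R

theorem cancel_tmul (x : E') (y : E) (r : R) :
    cancel K E E' R (x ⊗ₜ (y ⊗ₜ r)) = (y • x) ⊗ₜ r :=
  TensorProduct.AlgebraTensorModule.cancelBaseChange_tmul ..

theorem cancel_one : cancel K E E' R 1 = 1 := by
  rw [Algebra.TensorProduct.one_def, Algebra.TensorProduct.one_def, cancel_tmul, one_smul]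
  rfl

theorem cancel_mul (x y : E' ⊗[E] (E ⊗[K] R)) :
    cancel K E E' R (x * y) = cancel K E E' R x * cancel K E E' R y := by
  induction x using TensorProduct.induction_on with
  | zero => simp
  | add x x' hx hx' => rw [add_mul, map_add, hx, hx', map_add, add_mul]
  | tmul a s =>
    induction s using TensorProduct.induction_on with
    | zero => simp
    | add s s' hs hs' =>
      rw [TensorProduct.tmul_add, add_mul, map_add, hs, hs', map_add, add_mul]
    | tmul b r =>
      induction y using TensorProduct.induction_on with
      | zero => simp
      | add y y' hy hy' => rw [mul_add, map_add, hy, hy', map_add, mul_add]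
      | tmul c s =>
        induction s using TensorProduct.induction_on with
        | zero => simp
        | add s s' hs hs' =>
          rw [TensorProduct.tmul_add, mul_add, map_add, hs, hs', map_add, mul_add]
        | tmul d t =>
          rw [Algebra.TensorProduct.tmul_mul_tmul, Algebra.TensorProduct.tmul_mul_tmul,
            cancel_tmul, cancel_tmul, cancel_tmul, Algebra.TensorProduct.tmul_mul_tmul,
            smul_mul_smul_comm]

/-- The left action of `y ⊗ r ∈ E ⊗ R` corresponds to left multiplication by `y ⊗ r` in
`E' ⊗ R`. -/
theorem cancel_smul (y : E) (r : R) (x : E' ⊗[E] (E ⊗[K] R)) :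
    cancel K E E' R ((y ⊗ₜ[K] r : E ⊗[K] R) • x) =
      ((algebraMap E E' y) ⊗ₜ[K] r) * cancel K E E' R x := by
  rw [coeff_smul_def, cancel_mul, cancel_tmul, Algebra.algebraMap_eq_smul_one]

/-- The subspace of `E'` spanned over `K` by the products `w * u` with `w ∈ W` and `u` in a fixed
`E`-basis of `U`. -/
noncomputable def prodSub (U : FinSubspace E E') (W : FinSubspace K E) : FinSubspace K E' :=
  ⟨Submodule.span K (Set.range fun p : Fin (finrank K W.1) × Fin (finrank E U.1) =>
      (finBasis K W.1 p.1 : E) • (finBasis E U.1 p.2 : E')),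
    FiniteDimensional.span_of_finite K (Set.finite_range _), fun h => by
      have hli := linearIndependent_smul (linearIndependent_finBasis W.1)
        (linearIndependent_finBasis U.1)
      rw [Submodule.span_eq_bot] at h
      exact hli.ne_zero (⟨0, dim_pos W⟩, ⟨0, dim_pos U⟩) (h _ ⟨_, rfl⟩)⟩

theorem dim_prodSub (U : FinSubspace E E') (W : FinSubspace K E) :
    dim (prodSub U W) = dim W * dim U := by
  have hli := linearIndependent_smul (linearIndependent_finBasis W.1)
    (linearIndependent_finBasis U.1)
  exact (finrank_span_eq_card hli).trans (by simp [dim])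

theorem smul_mem_prodSub (U : FinSubspace E E') (W : FinSubspace K E) {y : E} (hy : y ∈ W.1)
    (a : Fin (finrank E U.1)) : y • (finBasis E U.1 a : E') ∈ (prodSub U W).1 := by
  rw [← span_range_finBasis W.1] at hy
  obtain ⟨c, rfl⟩ := (Submodule.mem_span_range_iff_exists_fun K).1 hy
  rw [Finset.sum_smul]
  refine Submodule.sum_mem _ fun d _ => ?_
  rw [smul_assoc]
  exact Submodule.smul_mem _ _ (Submodule.subset_span ⟨(d, a), rfl⟩)

theorem cancel_smul_mem (U : FinSubspace E E') (W : FinSubspace K E) {s : E ⊗[K] R}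
    (hs : s ∈ tensorSub R W) (a : Fin (finrank E U.1)) :
    cancel K E E' R (s • ((finBasis E U.1 a : E') ⊗ₜ[E] (1 : E ⊗[K] R))) ∈
      tensorSub R (prodSub U W) := by
  rw [coeff_smul_tmul, mul_one]
  induction hs using Submodule.span_induction with
  | mem x h =>
    obtain ⟨w, hw, r, rfl⟩ := h
    rw [cancel_tmul]
    exact Submodule.subset_span ⟨_, smul_mem_prodSub U W hw a, r, rfl⟩
  | zero => simp
  | add x y _ _ hx hy => rw [TensorProduct.tmul_add, map_add]; exact add_mem hx hy
  | smul c x _ hx =>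
    have : cancel K E E' R ((finBasis E U.1 a : E') ⊗ₜ[E] (c • x)) =
        c • cancel K E E' R ((finBasis E U.1 a : E') ⊗ₜ[E] x) := by
      rw [TensorProduct.tmul_smul]
      exact LinearMap.map_smul_of_tower (cancel K E E' R).toLinearMap c _
    rw [this]
    exact Submodule.smul_mem _ _ hx

/-- If `U` is invariant, then so is `prodSub U W` for all sufficiently invariant `W`. -/
theorem isInvariant_prodSub [Nontrivial R] {V : Finset (E' ⊗[K] R)} {δ : ℝ} (hδ : 0 < δ)
    {U : FinSubspace E E'} [DecidableEq (E' ⊗[E] (E ⊗[K] R))]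
    (hU : IsInvariant (V.image (cancel K E E' R).symm) δ U) :
    ∃ V₁ : Finset (E ⊗[K] R), ∀ W : FinSubspace K E, IsInvariant V₁ δ W →
      IsInvariant V ((1 + δ) * (1 + δ) - 1) (prodSub U W) := by
  classical
  obtain ⟨U', hd, hUU', hV⟩ := hU
  set V' := insert 1 (V.image (cancel K E E' R).symm)
  have hV' : ∀ v ∈ V', ∀ x ∈ tensorSub (E ⊗[K] R) U, x * v ∈ tensorSub (E ⊗[K] R) U' := by
    intro v hv x hx
    rcases Finset.mem_insert.1 hv with rfl | hv
    · rw [mul_one]; exact hUU' hx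
    · exact hV x hx v hv
  have huv : ∀ (v : V') (a : Fin (finrank E U.1)), ∃ c : Fin (finrank E U'.1) → E ⊗[K] R,
      ∑ b, c b • ((finBasis E U'.1 b : E') ⊗ₜ[E] (1 : E ⊗[K] R)) =
        ((finBasis E U.1 a : E') ⊗ₜ[E] (1 : E ⊗[K] R)) * v := by
    intro v a
    refine (Submodule.mem_span_range_iff_exists_fun _).1
      (mem_span_of_mem_tensorSub (W := U') (span_range_finBasis U'.1).ge (hV' v v.2 _ ?_))
    exact Submodule.subset_span ⟨_, (finBasis E U.1 a).2, 1, rfl⟩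
  choose c hc using huv
  let V₁ : Finset (E ⊗[K] R) := Finset.univ.image
    fun p : V' × Fin (finrank E U.1) × Fin (finrank E U'.1) => c p.1 p.2.1 p.2.2
  refine ⟨V₁, ?_⟩
  rintro W ⟨W', hdW, hWW', hW⟩
  have key : ∀ v ∈ V', ∀ x ∈ tensorSub R (prodSub U W),
      x * cancel K E E' R v ∈ tensorSub R (prodSub U' W') := by
    intro v hv x hx
    replace hx := mem_span_of_mem_tensorSub (W := prodSub U W) le_rfl hx
    induction hx using Submodule.span_induction with
    | mem x h =>
      obtain ⟨⟨d, a⟩, rfl⟩ := h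
      dsimp only
      have e1 : (((finBasis K W.1 d : E) • (finBasis E U.1 a : E')) ⊗ₜ[K] (1 : R)) =
          cancel K E E' R (((finBasis K W.1 d : E) ⊗ₜ[K] (1 : R)) •
            ((finBasis E U.1 a : E') ⊗ₜ[E] (1 : E ⊗[K] R))) := by
        rw [coeff_smul_tmul, mul_one, cancel_tmul]
      rw [e1, ← cancel_mul, smul_mul_assoc, ← hc ⟨v, hv⟩ a, Finset.smul_sum, _root_.map_sum]
      refine sum_mem fun b _ => ?_
      rw [smul_smul]
      apply cancel_smul_mem
      exact hW _ (tmul_one_mem_iff.2 (finBasis K W.1 d).2) _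
        (Finset.mem_image.2 ⟨((⟨v, hv⟩ : V'), a, b), Finset.mem_univ _, rfl⟩)
    | zero => rw [zero_mul]; exact zero_mem _
    | add x y _ _ hx hy => rw [add_mul]; exact add_mem hx hy
    | smul r x _ hx => rw [coeff_smul_def, mul_assoc]; exact smul_mem _ r hx
  refine ⟨prodSub U' W', ?_, fun x hx => ?_, fun x hx v hv => ?_⟩
  · rw [dim_prodSub, dim_prodSub]
    push_cast
    have := dim_pos_real U
    have := dim_pos_real W
    calc (dim W' : ℝ) * dim U' ≤ ((1 + δ) * dim W) * ((1 + δ) * dim U) := by gcongr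
      _ = _ := by ring
  · have := key 1 (Finset.mem_insert_self _ _) x hx
    rwa [cancel_one, mul_one] at this
  · have := key ((cancel K E E' R).symm v)
      (Finset.mem_insert_of_mem (Finset.mem_image_of_mem _ hv)) x hx
    rwa [LinearEquiv.apply_symm_apply] at this

variable {rk : MatrixFunction R} (hrk : IsSylvesterMatrixRank rk)
include hrk

/-- A matrix `C` over `E ⊗ R` that represents `A` on `U` over `E` also computes the rank of `A`
over `R` on all products of `U` with subspaces of `E`. -/
theorem exists_rankOn_prodSub {rk₁ : MatrixFunction (E ⊗[K] R)} (hrk₁ : IsSylvesterMatrixRank rk₁)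
    (U : FinSubspace E E') {n m : ℕ} (A : Matrix (Fin n) (Fin m) (E' ⊗[E] (E ⊗[K] R))) :
    ∃ (q k : ℕ) (C : Matrix (Fin q) (Fin k) (E ⊗[K] R)), rankOn rk₁ U A = rk₁ q k C ∧
      ∀ W : FinSubspace K E,
        rankOn rk (prodSub U W) (A.map (cancel K E E' R)) = rankOn rk W C := by
  classical
  obtain ⟨β, e, φ, C, hφ, hC, hr⟩ := exists_coord_matrix rk₁
    (fun (p : Fin n × Fin (finrank E U.1)) (j : Fin m) => (finBasis E U.1 p.2 : E') • A p.1 j)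
  refine ⟨_, _, Matrix.reindex (Fintype.equivFin _) (Fintype.equivFin _) C, ?_, fun W => ?_⟩
  · rw [rankOn_eq_tupRank hrk₁ (span_range_finBasis U.1)]
    exact hr
  rw [rankOn_eq_tupRank hrk (span_range_finBasis W.1), tupRank_reindex hrk,
    rankOn_eq_tupRank hrk (W := prodSub U W) rfl]
  -- the coordinates over `E ⊗ R` identify `(E ⊗ R) ^ β` with a direct summand
  have hsm : ∀ (r : R) (x : E' ⊗[E] (E ⊗[K] R)),
      cancel K E E' R (((1 : E) ⊗ₜ[K] r : E ⊗[K] R) • x) = r • cancel K E E' R x := by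
    intro r x
    rw [cancel_smul, map_one]
    rfl
  let Φ : (β → E ⊗[K] R) →ₗ[R] (Fin m → E' ⊗[K] R) :=
    { toFun := fun c j => cancel K E E' R ((∑ b, c b • e b) j)
      map_add' := fun x y => by
        ext j
        simp only [Pi.add_apply, add_smul, Finset.sum_add_distrib, map_add]
      map_smul' := fun r x => by
        ext j
        rw [RingHom.id_apply, Pi.smul_apply, ← hsm, ← Pi.smul_apply, Finset.smul_sum]
        simp only [smul_smul]
        rfl }
  let Ψ : (Fin m → E' ⊗[K] R) →ₗ[R] (β → E ⊗[K] R) :=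
    { toFun := fun x => φ fun j => (cancel K E E' R).symm (x j)
      map_add' := fun x y => by
        rw [← map_add]
        congr 1
        ext j
        exact map_add (cancel K E E' R).symm _ _
      map_smul' := fun r x => by
        have : (fun j => (cancel K E E' R).symm ((r • x) j)) =
            ((1 : E) ⊗ₜ[K] r : E ⊗[K] R) • fun j => (cancel K E E' R).symm (x j) := by
          ext j
          rw [LinearEquiv.symm_apply_eq, Pi.smul_apply, Pi.smul_apply, hsm,
            LinearEquiv.apply_symm_apply]
        rw [this, map_smul]
        rfl }
  have hΨ : ∀ x, Ψ (Φ x) = x := by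
    intro x
    refine Eq.trans ?_ (hφ x)
    simp only [Ψ, Φ, LinearMap.coe_mk, AddHom.coe_mk, LinearEquiv.symm_apply_apply]
  have hΦ : ∀ i a d, Φ (fun b => (finBasis K W.1 d : E) • C (i, a) b) =
      fun j => ((finBasis K W.1 d : E) • (finBasis E U.1 a : E')) •
        (A.map (cancel K E E' R)) i j := by
    intro i a d
    have h1 : ∑ b, ((finBasis K W.1 d : E) • C (i, a) b) • e b =
        ((finBasis K W.1 d : E) ⊗ₜ[K] (1 : R)) •
          fun j => (finBasis E U.1 a : E') • A i j := by
      rw [hC (i, a), Finset.smul_sum]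
      simp only [smul_smul, tmul_one_mul]
    ext j
    simp only [Φ, LinearMap.coe_mk, AddHom.coe_mk]
    rw [h1, Pi.smul_apply, cancel_smul, tmul_one_mul, map_smul, smul_smul, ← Algebra.smul_def,
      Matrix.map_apply]
  unfold tupRank
  rw [← famRank_map_eq hrk Φ Ψ hΨ]
  apply le_antisymm
  · apply famRank_mono hrk
    rintro ⟨i, d, a⟩
    exact Submodule.subset_span ⟨((i, a), d), hΦ i a d⟩
  · apply famRank_mono hrk
    rintro ⟨⟨i, a⟩, d⟩
    exact Submodule.subset_span ⟨(i, d, a), (hΦ i a d).symm⟩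

/-- The iterated extension is the extension along the iterated limit of the subspaces
`prodSub U W`. -/
theorem rankExt_rankExt {ω₁ : Ultrafilter (FinSubspace K E)} {ω₂ : Ultrafilter (FinSubspace E E')}
    {ω : Ultrafilter (FinSubspace K E')} (hω₁ : NonPrincipal R ω₁)
    (hω₂ : NonPrincipal (E ⊗[K] R) ω₂) (hω : NonPrincipal R ω) {n m : ℕ}
    (A : Matrix (Fin n) (Fin m) (E' ⊗[E] (E ⊗[K] R))) :
    rankExt (rankExt rk ω₁) ω₂ n m A = rankExt rk ω n m (A.map (cancel K E E' R)) := by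
  classical
  have := hrk.nontrivial
  have hrk₁ := isSylvesterMatrixRank_rankExt hrk hω₁
  let ω' : Ultrafilter (FinSubspace K E') := ω₂.bind fun U => ω₁.map (prodSub U)
  have hmem : ∀ s : Set (FinSubspace K E'), s ∈ ω' ↔
      ∀ᶠ U in (ω₂ : Filter (FinSubspace E E')), ∀ᶠ W in (ω₁ : Filter (FinSubspace K E)),
        prodSub U W ∈ s := fun s => Iff.rfl
  have hω' : NonPrincipal R ω' := by
    intro V ε hε
    obtain ⟨δ, hδ, hδ2⟩ : ∃ δ : ℝ, 0 < δ ∧ (1 + δ) * (1 + δ) - 1 ≤ ε := by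
      refine ⟨min 1 (ε / 3), by positivity, ?_⟩
      have h1 := min_le_left 1 (ε / 3)
      have h2 := min_le_right 1 (ε / 3)
      have h3 : 0 < min 1 (ε / 3) := by positivity
      nlinarith
    rw [hmem]
    filter_upwards [hω₂ (V.image (cancel K E E' R).symm) δ hδ] with U hU
    obtain ⟨V₁, hV₁⟩ := isInvariant_prodSub hδ hU
    filter_upwards [hω₁ V₁ δ hδ] with W hW
    exact (hV₁ W hW).mono subset_rfl hδ2
  rw [rankExt_eq_of_nonPrincipal hrk hω hω']
  refine tendsto_nhds_unique (tendsto_rankExt hrk₁ ω₂ A) ?_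
  rw [Metric.tendsto_nhds]
  intro ε hε
  have hlim := (tendsto_rankExt hrk ω' (A.map (cancel K E E' R))).eventually
    (Metric.closedBall_mem_nhds _ (half_pos hε))
  filter_upwards [(hmem _).1 hlim] with U hU
  obtain ⟨q, k, C, hC, hCW⟩ := exists_rankOn_prodSub hrk hrk₁ U A
  -- along `ω₁`, the normalized ranks on `prodSub U W` converge to the normalized rank on `U`
  have hconv : Filter.Tendsto (fun W => rankOn rk (prodSub U W) (A.map (cancel K E E' R)) /
      (dim (prodSub U W) : ℝ)) ω₁ (nhds (rankOn (rankExt rk ω₁) U A / (dim U : ℝ))) := by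
    rw [hC]
    refine ((tendsto_rankExt hrk ω₁ C).div_const _).congr fun W => ?_
    rw [hCW, dim_prodSub, div_div, Nat.cast_mul]
  have := Metric.isClosed_closedBall.mem_of_tendsto hconv hU
  exact (Metric.mem_closedBall.1 this).trans_lt (half_lt_self hε)

end Iterated

end FieldExt

theorem proposition9p1 {K E E' R : Type*} [Field K] [Field E] [Field E']
    [Algebra K E] [Algebra E E'] [Algebra K E'] [IsScalarTower K E E']
    [Ring R] [Algebra K R] (rk : MatrixFunction R) (hrk : IsSylvesterMatrixRank rk) :
    (∃ ω₁ : Ultrafilter (FinSubspace K E), FieldExt.NonPrincipal R ω₁) ∧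
    (∃ ω₂ : Ultrafilter (FinSubspace E E'), FieldExt.NonPrincipal (E ⊗[K] R) ω₂) ∧
    (∃ ω : Ultrafilter (FinSubspace K E'), FieldExt.NonPrincipal R ω) ∧
    ∀ (ω₁ : Ultrafilter (FinSubspace K E)) (ω₂ : Ultrafilter (FinSubspace E E'))
      (ω : Ultrafilter (FinSubspace K E')),
      FieldExt.NonPrincipal R ω₁ → FieldExt.NonPrincipal (E ⊗[K] R) ω₂ →
      FieldExt.NonPrincipal R ω →
      IsSylvesterMatrixRank (FieldExt.rankExt rk ω₁) ∧
      IsSylvesterMatrixRank (FieldExt.rankExt (FieldExt.rankExt rk ω₁) ω₂) ∧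
      IsSylvesterMatrixRank (FieldExt.rankExt rk ω) ∧
      ∀ (n m : ℕ) (A : Matrix (Fin n) (Fin m) (E' ⊗[E] (E ⊗[K] R))),
        FieldExt.rankExt (FieldExt.rankExt rk ω₁) ω₂ n m A =
          FieldExt.rankExt rk ω n m
            (A.map (TensorProduct.AlgebraTensorModule.cancelBaseChange K E E' E' R)) := by
  refine ⟨FieldExt.exists_nonPrincipal K E R, FieldExt.exists_nonPrincipal E E' (E ⊗[K] R),
    FieldExt.exists_nonPrincipal K E' R, fun ω₁ ω₂ ω h₁ h₂ h => ?_⟩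
  have hrk₁ := FieldExt.isSylvesterMatrixRank_rankExt hrk h₁
  exact ⟨hrk₁, FieldExt.isSylvesterMatrixRank_rankExt hrk₁ h₂,
    FieldExt.isSylvesterMatrixRank_rankExt hrk h,
    fun n m A => FieldExt.rankExt_rankExt hrk h₁ h₂ h A⟩
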